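/- **Signature and laws.** A $p\mathcal{BC}+$ signature $\sigma$ has finitely many constants, each with a finite domain: fluent constants (regular or statically determined), Boolean action constants, pf constants, and initpf constants. An action description $D$ consists of finitely many - static laws "caused $F$ if $G$" ($F,G$ fluent formulas); - fluent dynamic laws "caused $F$ if $G$ after $H$" ($F,G$ fluent formulas, $F$ without statically determined constants, $H$ without initpf constants); - initial static laws "initially $F$ if $G$" ($F$ a fluent formula, $G$ without action and pf constants); - utility laws "reward $v$ if $F$ after $G$" ($v\in\mathbb R$, $F$ a fluent formula, $G$ over fluent and action constants); - for each pf and each initpf constant $c$ one declaration of a probability distribution $M(c=\cdot)$ on its domain, with $0<M(c=v)<1$ and $\sum_v M(c=v)=1$. **Programs.** An $\mathrm{LP}^{\mathrm{MLN}}$ program $\Pi$ consists of hard rules and of soft rules $w:R$ with $w\in\mathbb R$. $\mathrm{SM}[\Pi]$ is the set of the interpretations $I$ that satisfy all hard rules and are stable models (in the sense of reducts of propositional formulas) of the set of all rules of $\Pi$ satisfied by $I$. The weight $W_\Pi(I)$ is $\exp$ of the sum of the weights of the soft rules satisfied by $I$ if $I\in \mathrm{SM}[\Pi]$, and $0$ otherwise;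 $P_\Pi(I)=W_\Pi(I)/\sum_{J\in \mathrm{SM}[\Pi]}W_\Pi(J)$. Further, $U_\Pi(I)=\sum_{\mathtt{utility}(u,\mathbf t)\in I}u$ and $E[U_\Pi(A)]=\sum_{I\models A}U_\Pi(I)\,P_\Pi(I\mid A)$. The elements of $\mathrm{SM}[\Pi]$ are called the stable models of $\Pi$. For $m\ge 0$ the program $D_m$, over atoms $i\!:\!c=v$ (with $0\le i\le m$ for fluent constants and $0\le i<m$ for action and pf constants) and utility atoms, has the hard rules - $i\!:\!F\leftarrow i\!:\!G$ for the static laws, $0\le i\le m$; - $i{+}1\!:\!F\leftarrow (i{+}1\!:\!G)\wedge (i\!:\!H)$ for the dynamic laws, $0\le i<m$; - $\mathtt{utility}(v,i{+}1,id)\leftarrow (i{+}1\!:\!F)\wedge(i\!:\!G)$ for the utility laws, $0\le i<m$, where $id$ is unique to each such ground rule; - the choice rules $\{0\!:\!c=v\}^{\rm ch}$ for regular fluent constants $c$ and $\{i\!:\!c=v\}^{\rm ch}$ for action constants $c$, $0\le i<m$; - constraints saying that each constant has exactly one value; and the soft rules $\ln M(c=v):\ i\!:\!c=v$ for pf constants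 $c$, $0\le i<m$. The program $D_{init}$ has the hard rules $\bot\leftarrow\neg(0\!:\!F)\wedge 0\!:\!G$ for the initial static laws and the exactly-one-value constraints for the initpf constants and the fluent constants at time $0$, and the soft rules $\ln M(c=v):\ 0\!:\!c=v$ for initpf constants $c$. Let $Tr(D,m)=D_{init}\cup D_m$. **States, actions, transitions.** $\mathbf S$ is the set of assignments $s$ to the fluent constants such that $0\!:\!s$ extends to a stable model of $D_0$. $\mathbf A$ is the set of assignments $e$ to the action constants such that $0\!:\!e$ extends to a stable model of $D_1$. A triple $\langle s,e,s'\rangle$ is a transition if $0\!:\!s\cup0\!:\!e\cup1\!:\!s'$ extends to a stable model of $D_1$; $(\langle s,e,s'\rangle,pf)$ is a pf-transition if $0\!:\!s\cup0\!:\!e\cup1\!:\!s'\cup0\!:\!pf$, together with the utility atoms it entails, is a stable model of $D_1$. A state $s$ is consistent with $D_{init}$ if some stable model of $D_{init}\cup D_0$ satisfies $0\!:\!s$. **Policies.** A (non-stationary) policy is a map $\pi:\mathbf S\times\{0,\dots,m-1\}\to\mathbf A$, and $C_{\pi,m}=\bigwedge_{s\in\mathbf S,\,0\le i<m}\big(i\!:\!s\rightarrow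 i\!:\!\pi(s,i)\big)$. **The MDP $M(D)$** has states $\mathbf S$, actions $\mathbf A$, transition probabilities $T(s,a,s')=P_{D_1}(1\!:\!s'\mid 0\!:\!s\wedge0\!:\!a)$ and rewards $R(s,a,s')=E[U_{D_1}(0\!:\!s\wedge0\!:\!a\wedge1\!:\!s')]$ (taken as $0$ if the condition has probability $0$), and $$ER_{M(D)}(\pi,s_0)=\sum_{s_1,\dots,s_m\in\mathbf S}\Big(\sum_{i=0}^{m-1}R(s_i,\pi(s_i,i),s_{i+1})\Big)\prod_{i=0}^{m-1}T(s_i,\pi(s_i,i),s_{i+1}).$$ **Theorem.** Assume that 1. in every transition $\langle s,e,s'\rangle$ at most one action constant is true in $e$; 2. for every state $s$, every assignment $e$ to the action constants with at most one action constant true and every assignment $pf$ to the pf constants there is exactly one state $s'$ such that $(\langle s,e,s'\rangle,pf)$ is a pf-transition; 3. for every assignment $q$ to the initpf constants there is exactly one assignment $s$ to the fluent constants such that $0\!:\!q\cup0\!:\!s$ is a stable model of $D_{init}\cup D_0$. Then for every integer $m\ge0$ and every $s_0\in\mathbf S$ that is consistent with $D_{init}$, every non-stationary policy $\pi$ satisfies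 $$E[U_{Tr(D,m)}(C_{\pi,m}\wedge 0\!:\!s_0)]=ER_{M(D)}(\pi,s_0),$$ and consequently $$\operatorname*{argmax}_{\pi}\,E[U_{Tr(D,m)}(C_{\pi,m}\wedge 0\!:\!s_0)]=\operatorname*{argmax}_{\pi}\,ER_{M(D)}(\pi,s_0).$$ -/

import Mathlib

namespace PBC

/-! ## Propositional formulas and stable models -/

/-- Propositional formulas over the atoms `α`. -/
inductive Formula (α : Type) : Type
  | bot : Formula α
  | atom : α → Formula α
  | and : Formula α → Formula α → Formula α
  | or : Formula α → Formula α → Formula α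
  | imp : Formula α → Formula α → Formula α

namespace Formula

variable {α β : Type}

/-- `¬ F`, which is `F → ⊥`. -/
def neg (F : Formula α) : Formula α := imp F bot

/-- `⊤`, which is `⊥ → ⊥`. -/
def top : Formula α := imp bot bot

/-- The formula obtained by renaming the atoms along `f`. -/
def map (f : α → β) : Formula α → Formula β
  | bot => bot
  | atom a => atom (f a)
  | and F G => and (F.map f) (G.map f)
  | or F G => or (F.map f) (G.map f)
  | imp F G => imp (F.map f) (G.map f)

/-- Classical satisfaction; an interpretation is the set of the atoms it makes true. -/
def Sat (I : Set α) : Formula α → Prop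
  | bot => False
  | atom a => a ∈ I
  | and F G => Sat I F ∧ Sat I G
  | or F G => Sat I F ∨ Sat I G
  | imp F G => Sat I F → Sat I G

open Classical in
/-- The reduct `F^I`: every maximal subformula that `I` does not satisfy is replaced by `⊥`. -/
noncomputable def reduct (I : Set α) : Formula α → Formula α
  | bot => bot
  | atom a => if a ∈ I then atom a else bot
  | and F G => if Sat I (and F G) then and (F.reduct I) (G.reduct I) else bot
  | or F G => if Sat I (or F G) then or (F.reduct I) (G.reduct I) else bot
  | imp F G => if Sat I (imp F G) then imp (F.reduct I) (G.reduct I) else bot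

/-- The conjunction of a finite family of formulas. -/
noncomputable def conj {ι : Type} [Fintype ι] (f : ι → Formula α) : Formula α :=
  (Finset.univ.toList.map f).foldr and top

/-- The disjunction of a finite family of formulas. -/
noncomputable def disj {ι : Type} [Fintype ι] (f : ι → Formula α) : Formula α :=
  (Finset.univ.toList.map f).foldr or bot

/-- The rule `F ← G`, that is, the implication `G → F`. -/
def rule (F G : Formula α) : Formula α := imp G F

/-- The choice rule `{a}^ch`, that is, `a ← not not a`. -/
def choice (a : α) : Formula α := rule (atom a) (neg (neg (atom a)))

theorem sat_conj {ι : Type} [Fintype ι] (I : Set α) (f : ι → Formula α) :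
    Sat I (conj f) ↔ ∀ x, Sat I (f x) := by
  have h : ∀ l : List ι, Sat I ((l.map f).foldr and top) ↔ ∀ x ∈ l, Sat I (f x) := by
    intro l
    induction l with
    | nil => simp [Sat, top]
    | cons a l ih => simp [Sat, ih]
  simp [conj, h]

theorem sat_disj {ι : Type} [Fintype ι] (I : Set α) (f : ι → Formula α) :
    Sat I (disj f) ↔ ∃ x, Sat I (f x) := by
  have h : ∀ l : List ι, Sat I ((l.map f).foldr or bot) ↔ ∃ x ∈ l, Sat I (f x) := by
    intro l
    induction l with
    | nil => simp [Sat]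
    | cons a l ih => simp [Sat, ih]
  simp [disj, h]

end Formula

/-- `I` is a (deterministic) stable model of the set of formulas `Γ`: it is minimal, with respect
to inclusion, among the sets of atoms that satisfy the reduct of `Γ` relative to `I`. -/
def IsStableModel {α : Type} (Γ : Set (Formula α)) (I : Set α) : Prop :=
  (∀ F ∈ Γ, (F.reduct I).Sat I) ∧ ∀ J : Set α, J ⊂ I → ¬ ∀ F ∈ Γ, (F.reduct I).Sat J

/-! ## LP^MLN programs with utilities -/

/-- A ground DT-LP^MLN program over the atoms `α`: hard rules (weight `α`), soft rules (pairs of a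
real weight and a rule), and the value `u` of every utility atom `utility(u, t)`.
Atoms that are not utility atoms get the value `0`, so that they do not count for the utility. -/
structure Program (α : Type) where
  hard : Set (Formula α)
  soft : Finset (ℝ × Formula α)
  value : α → ℝ

namespace Program

variable {α : Type} (P : Program α)

/-- The (unweighted) rules of the program that `I` satisfies. -/
def satisfiedRules (I : Set α) : Set (Formula α) :=
  {R | (R ∈ P.hard ∨ ∃ w : ℝ, (w, R) ∈ P.soft) ∧ R.Sat I}

/-- `SM[Π]`: the stable models of `Π_I` that satisfy all hard rules of `Π`. -/
def SM : Set (Set α) :=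
  {I | IsStableModel (P.satisfiedRules I) I ∧ ∀ R ∈ P.hard, R.Sat I}

open Classical in
/-- The weight of an interpretation. All elements of `SM` satisfy the same hard rules, namely all
of them, so the common factor that stems from the hard rules is left out; it cancels in `prob`. -/
noncomputable def weight (I : Set α) : ℝ :=
  if I ∈ P.SM then Real.exp (∑ r ∈ P.soft with r.2.Sat I, r.1) else 0

theorem weight_nonneg (I : Set α) : 0 ≤ P.weight I := by
  unfold weight
  split_ifs
  · exact (Real.exp_pos _).le
  · exact le_rfl

variable [Fintype α]

open Classical in
/-- The probability of an interpretation. -/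
noncomputable def probInterp (I : Set α) : ℝ :=
  P.weight I / ∑ J : Set α with J ∈ P.SM, P.weight J

open Classical in
/-- The probability of a formula. -/
noncomputable def prob (A : Formula α) : ℝ :=
  ∑ I : Set α with A.Sat I, P.probInterp I

/-- The conditional probability of `B` given `A`. -/
noncomputable def condProb (B A : Formula α) : ℝ := P.prob (A.and B) / P.prob A

open Classical in
/-- The utility of an interpretation: the sum of `u` over all `utility(u, t)` in it. -/
noncomputable def utility (I : Set α) : ℝ := ∑ a : α with a ∈ I, P.value a

open Classical in
/-- The expected utility of `A`: the sum, over the interpretations `I` that satisfy `A`, of the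
utility of `I` times the probability of `I` given `A`. -/
noncomputable def expectedUtility (A : Formula α) : ℝ :=
  ∑ I : Set α with A.Sat I, P.utility I * (P.probInterp I / P.prob A)

theorem probInterp_nonneg (I : Set α) : 0 ≤ P.probInterp I :=
  div_nonneg (P.weight_nonneg I) (Finset.sum_nonneg fun J _ => P.weight_nonneg J)

theorem prob_nonneg (A : Formula α) : 0 ≤ P.prob A :=
  Finset.sum_nonneg fun I _ => P.probInterp_nonneg I

theorem condProb_mem_Icc (B A : Formula α) : P.condProb B A ∈ Set.Icc (0 : ℝ) 1 := by
  refine ⟨div_nonneg (P.prob_nonneg _) (P.prob_nonneg _),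
    div_le_one_of_le₀ ?_ (P.prob_nonneg _)⟩
  refine Finset.sum_le_sum_of_subset_of_nonneg ?_ fun I _ _ => P.probInterp_nonneg I
  intro I hI
  simp only [Finset.mem_filter, Finset.mem_univ, true_and] at hI ⊢
  exact hI.1

end Program

/-! ## Syntax of pBC+ -/

/-- A multi-valued signature: finitely many fluent, action, pf and initpf constants with finite
domains. Action constants are Boolean; fluent constants that are not regular are statically
determined. -/
structure Signature where
  Fl : Type
  Act : Type
  Pf : Type
  Initpf : Type
  regular : Fl → Prop
  flDom : Fl → Type
  pfDom : Pf → Type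
  initpfDom : Initpf → Type
  [fintypeFl : Fintype Fl]
  [fintypeAct : Fintype Act]
  [fintypePf : Fintype Pf]
  [fintypeInitpf : Fintype Initpf]
  [fintypeFlDom : ∀ c, Fintype (flDom c)]
  [fintypePfDom : ∀ c, Fintype (pfDom c)]
  [fintypeInitpfDom : ∀ c, Fintype (initpfDom c)]

attribute [instance] Signature.fintypeFl Signature.fintypeAct Signature.fintypePf
  Signature.fintypeInitpf Signature.fintypeFlDom Signature.fintypePfDom
  Signature.fintypeInitpfDom

namespace Signature

variable (σ : Signature)

/-- Atoms `c = v` for fluent constants. -/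
abbrev FlAtom : Type := Σ c : σ.Fl, σ.flDom c

/-- Atoms `c = v` for regular fluent constants. -/
abbrev RegAtom : Type := Σ c : {c : σ.Fl // σ.regular c}, σ.flDom c

/-- Atoms `c = v` for action constants. -/
abbrev ActAtom : Type := σ.Act × Bool

/-- Atoms `c = v` for pf constants. -/
abbrev PfAtom : Type := Σ c : σ.Pf, σ.pfDom c

/-- Atoms `c = v` for initpf constants. -/
abbrev InitpfAtom : Type := Σ c : σ.Initpf, σ.initpfDom c

/-- Value assignments to the fluent constants. -/
abbrev FlAssign : Type := ∀ c : σ.Fl, σ.flDom c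

/-- Value assignments to the action constants. -/
abbrev ActAssign : Type := σ.Act → Bool

/-- Value assignments to the pf constants. -/
abbrev PfAssign : Type := ∀ c : σ.Pf, σ.pfDom c

/-- Value assignments to the initpf constants. -/
abbrev InitpfAssign : Type := ∀ c : σ.Initpf, σ.initpfDom c

end Signature

/-- `caused head if body`, for fluent formulas. -/
structure StaticLaw (σ : Signature) where
  head : Formula σ.FlAtom
  body : Formula σ.FlAtom

/-- `caused head if body after pre`: `head` and `body` are fluent formulas, `head` does not
contain statically determined constants, `pre` does not contain initpf constants. -/
structure DynamicLaw (σ : Signature) where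
  head : Formula σ.RegAtom
  body : Formula σ.FlAtom
  pre : Formula (σ.FlAtom ⊕ σ.ActAtom ⊕ σ.PfAtom)

/-- `initially head if body`: `body` contains neither action constants nor pf constants. -/
structure InitialLaw (σ : Signature) where
  head : Formula σ.FlAtom
  body : Formula (σ.FlAtom ⊕ σ.InitpfAtom)

/-- `reward v if body after pre`: `body` contains fluent constants only, `pre` contains fluent and
action constants only. -/
structure UtilityLaw (σ : Signature) where
  reward : ℝ
  body : Formula σ.FlAtom
  pre : Formula (σ.FlAtom ⊕ σ.ActAtom)

/-- A pBC+ action description with utilities: finitely many laws, and for each pf constant and each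
initpf constant the declaration of its probability distribution. -/
structure ActionDescription (σ : Signature) where
  staticLaws : Finset (StaticLaw σ)
  dynamicLaws : Finset (DynamicLaw σ)
  initialLaws : Finset (InitialLaw σ)
  utilityLaws : Finset (UtilityLaw σ)
  pfProb : ∀ c : σ.Pf, σ.pfDom c → ℝ
  pfProb_pos : ∀ c v, 0 < pfProb c v
  pfProb_lt_one : ∀ c v, pfProb c v < 1
  pfProb_sum : ∀ c, ∑ v, pfProb c v = 1
  initpfProb : ∀ c : σ.Initpf, σ.initpfDom c → ℝ
  initpfProb_pos : ∀ c v, 0 < initpfProb c v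
  initpfProb_lt_one : ∀ c v, initpfProb c v < 1
  initpfProb_sum : ∀ c, ∑ v, initpfProb c v = 1

/-! ## Markov decision processes -/

/-- A Markov decision process with the states `S` and the actions `A`. -/
structure MDP (S A : Type) where
  T : S → A → S → ℝ
  R : S → A → S → ℝ
  T_mem : ∀ s a s', T s a s' ∈ Set.Icc (0 : ℝ) 1

namespace MDP

variable {S A : Type} (M : MDP S A) {m : ℕ}

/-- The total reward of the history `s 0, a 0, s 1, …, a (m-1), s m`. -/
def totalReward (s : Fin (m + 1) → S) (a : Fin m → A) : ℝ :=
  ∑ i : Fin m, M.R (s i.castSucc) (a i) (s i.succ)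

/-- The probability of the history `s 0, a 0, s 1, …, a (m-1), s m`. -/
def historyProb (s : Fin (m + 1) → S) (a : Fin m → A) : ℝ :=
  ∏ i : Fin m, M.T (s i.castSucc) (a i) (s i.succ)

/-- The expected total reward `ER_M(π, s₀)` of the non-stationary policy `π`; the sum is over all
`s₁, …, s_m`. -/
noncomputable def expectedTotalReward [Fintype S] (π : S × Fin m → A) (s₀ : S) : ℝ :=
  ∑ t : Fin m → S,
    let s : Fin (m + 1) → S := Fin.cons s₀ t
    let a : Fin m → A := fun i => π (s i.castSucc, i)
    M.totalReward s a * M.historyProb s a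

end MDP

/-- The set of the maximizers of `f`. -/
def argmax {X : Type} (f : X → ℝ) : Set X := {x | ∀ y, f y ≤ f x}

/-! ## Semantics of pBC+ -/

namespace ActionDescription

variable {σ : Signature} (D : ActionDescription σ)

/-- The atoms of `Tr(D, m)`: `i : c = v` for fluent constants and `i ≤ m`, for action and pf
constants and `i < m`, for initpf constants and `i = 0`; and the utility atoms.
The atom `utility l i` is `utility(v, i + 1, id)`, where `v` is the reward of the law `l` and `id`
is the identifier of the ground rule that `l` yields at time `i`. -/
inductive Atom (m : ℕ) : Type
  | fl (i : Fin (m + 1)) (c : σ.Fl) (v : σ.flDom c) : Atom m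
  | act (i : Fin m) (c : σ.Act) (v : Bool) : Atom m
  | pf (i : Fin m) (c : σ.Pf) (v : σ.pfDom c) : Atom m
  | initpf (c : σ.Initpf) (v : σ.initpfDom c) : Atom m
  | utility (l : {l : UtilityLaw σ // l ∈ D.utilityLaws}) (i : Fin m) : Atom m

variable (m : ℕ)

noncomputable instance : Fintype (D.Atom m) :=
  Fintype.ofInjective
    (β := (Fin (m + 1) × σ.FlAtom) ⊕ (Fin m × σ.ActAtom) ⊕ (Fin m × σ.PfAtom) ⊕ σ.InitpfAtom ⊕
      ({l : UtilityLaw σ // l ∈ D.utilityLaws} × Fin m))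
    (fun a => match a with
      | .fl i c v => .inl (i, ⟨c, v⟩)
      | .act i c v => .inr (.inl (i, (c, v)))
      | .pf i c v => .inr (.inr (.inl (i, ⟨c, v⟩)))
      | .initpf c v => .inr (.inr (.inr (.inl ⟨c, v⟩)))
      | .utility l i => .inr (.inr (.inr (.inr (l, i)))))
    (by
      intro a b h
      cases a <;> cases b <;> simp_all)

variable {m}

/-- The fluent atom `i : c = v`. -/
def flAt (i : Fin (m + 1)) (a : σ.FlAtom) : D.Atom m := .fl i a.1 a.2

/-- The regular fluent atom `i : c = v`. -/
def regAt (i : Fin (m + 1)) (a : σ.RegAtom) : D.Atom m := .fl i a.1.1 a.2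

/-- The action atom `i : c = v`. -/
def actAt (i : Fin m) (a : σ.ActAtom) : D.Atom m := .act i a.1 a.2

/-- The pf atom `i : c = v`. -/
def pfAt (i : Fin m) (a : σ.PfAtom) : D.Atom m := .pf i a.1 a.2

/-- The initpf atom `0 : c = v`. -/
def initpfAt (a : σ.InitpfAtom) : D.Atom m := .initpf a.1 a.2

open Formula

variable (m)

/-- `i : F ← i : G`, for the static laws and `i = 0, …, m`. -/
def staticRules : Set (Formula (D.Atom m)) :=
  {R | ∃ l ∈ D.staticLaws, ∃ i : Fin (m + 1),
    R = rule (l.head.map (D.flAt i)) (l.body.map (D.flAt i))}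

/-- `i+1 : F ← (i+1 : G) ∧ (i : H)`, for the fluent dynamic laws and `i = 0, …, m-1`. -/
def dynamicRules : Set (Formula (D.Atom m)) :=
  {R | ∃ l ∈ D.dynamicLaws, ∃ i : Fin m,
    R = rule (l.head.map (D.regAt i.succ))
      ((l.body.map (D.flAt i.succ)).and
        (l.pre.map (Sum.elim (D.flAt i.castSucc) (Sum.elim (D.actAt i) (D.pfAt i)))))}

/-- `utility(v, i+1, id) ← (i+1 : F) ∧ (i : G)`, for the utility laws and `i = 0, …, m-1`. -/
def utilityRules : Set (Formula (D.Atom m)) :=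
  {R | ∃ (l : {l : UtilityLaw σ // l ∈ D.utilityLaws}) (i : Fin m),
    R = rule (atom (.utility l i))
      ((l.1.body.map (D.flAt i.succ)).and
        (l.1.pre.map (Sum.elim (D.flAt i.castSucc) (D.actAt i))))}

/-- The choice rules for the regular fluents at time `0` and for the actions. -/
def choiceRules : Set (Formula (D.Atom m)) :=
  {R | (∃ a : σ.RegAtom, R = choice (D.regAt 0 a)) ∨
    ∃ (i : Fin m) (a : σ.ActAtom), R = choice (D.actAt i a)}

/-- `⊥ ← ¬ (0 : F) ∧ 0 : G`, for the initial static laws. -/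
def initialRules : Set (Formula (D.Atom m)) :=
  {R | ∃ l ∈ D.initialLaws,
    R = rule bot ((neg (l.head.map (D.flAt 0))).and
      (l.body.map (Sum.elim (D.flAt 0) D.initpfAt)))}

variable {m} in
/-- The uniqueness and existence of value constraints for a constant whose atoms `c = v` are the
`f v`: `⊥ ← f v ∧ f w` for `v ≠ w`, and `⊥ ← ¬ ⋁ v, f v`. -/
def valueConstraints {V : Type} [Fintype V] (f : V → D.Atom m) : Set (Formula (D.Atom m)) :=
  {R | (∃ v w, v ≠ w ∧ R = rule bot ((atom (f v)).and (atom (f w)))) ∨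
    R = rule bot (neg (disj fun v => atom (f v)))}

variable {m} in
/-- The value of a utility atom is its first argument. -/
def atomValue : D.Atom m → ℝ
  | .utility l _ => l.1.reward
  | _ => 0

open Classical in
/-- The program `D_m`. It is written over the atoms of `Tr(D, m)`; it has no rule about initpf
atoms, so these are false in all of its stable models. -/
noncomputable def prog : Program (D.Atom m) where
  hard := D.staticRules m ∪ D.dynamicRules m ∪ D.utilityRules m ∪ D.choiceRules m ∪
    (⋃ (i : Fin (m + 1)) (c : σ.Fl), D.valueConstraints (Atom.fl i c)) ∪
    (⋃ (i : Fin m) (c : σ.Act), D.valueConstraints (Atom.act i c)) ∪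
    (⋃ (i : Fin m) (c : σ.Pf), D.valueConstraints (Atom.pf i c))
  soft := Finset.univ.image fun x : Fin m × σ.PfAtom =>
    (Real.log (D.pfProb x.2.1 x.2.2), atom (D.pfAt x.1 x.2))
  value := D.atomValue

open Classical in
/-- The program `D_init`, with its signature embedded in that of `Tr(D, m)`. -/
noncomputable def initProg : Program (D.Atom m) where
  hard := D.initialRules m ∪
    (⋃ c : σ.Initpf, D.valueConstraints (Atom.initpf c)) ∪
    (⋃ c : σ.Fl, D.valueConstraints (Atom.fl 0 c))
  soft := Finset.univ.image fun a : σ.InitpfAtom =>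
    (Real.log (D.initpfProb a.1 a.2), atom (D.initpfAt a))
  value := D.atomValue

open Classical in
/-- The program `Tr(D, m) = D_init ∪ D_m`. -/
noncomputable def Tr : Program (D.Atom m) where
  hard := (D.initProg m).hard ∪ (D.prog m).hard
  soft := (D.initProg m).soft ∪ (D.prog m).soft
  value := D.atomValue

variable {m}

/-- On the fluent atoms of time `i`, the interpretation `X` is `i : s`. -/
def FlEq (X : Set (D.Atom m)) (i : Fin (m + 1)) (s : σ.FlAssign) : Prop :=
  ∀ c v, Atom.fl i c v ∈ X ↔ s c = v

/-- On the action atoms of time `i`, the interpretation `X` is `i : e`. -/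
def ActEq (X : Set (D.Atom m)) (i : Fin m) (e : σ.ActAssign) : Prop :=
  ∀ c v, Atom.act i c v ∈ X ↔ e c = v

/-- On the pf atoms of time `i`, the interpretation `X` is `i : p`. -/
def PfEq (X : Set (D.Atom m)) (i : Fin m) (p : σ.PfAssign) : Prop :=
  ∀ c v, Atom.pf i c v ∈ X ↔ p c = v

/-- On the initpf atoms, the interpretation `X` is `0 : q`. -/
def InitpfEq (X : Set (D.Atom m)) (q : σ.InitpfAssign) : Prop :=
  ∀ c v, Atom.initpf c v ∈ X ↔ q c = v

/-- `s` is a state: `0 : s` is a residual stable model of `D_0`. -/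
def IsState (s : σ.FlAssign) : Prop := ∃ X ∈ (D.prog 0).SM, D.FlEq X 0 s

/-- `e` is an element of the action set: `0 : e` is a residual stable model of `D_1`. -/
def IsAction (e : σ.ActAssign) : Prop := ∃ X ∈ (D.prog 1).SM, D.ActEq X 0 e

/-- `⟨s, e, s'⟩` is a transition: `0 : s ∪ 0 : e ∪ 1 : s'` is a residual stable model of `D_1`. -/
def IsTransition (s : σ.FlAssign) (e : σ.ActAssign) (s' : σ.FlAssign) : Prop :=
  ∃ X ∈ (D.prog 1).SM, D.FlEq X 0 s ∧ D.ActEq X 0 e ∧ D.FlEq X 1 s'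

/-- `(⟨s, e, s'⟩, p)` is a pf-transition: `0 : s ∪ 0 : e ∪ 1 : s' ∪ 0 : p`, together with the
utility atoms it entails, is a stable model of `D_1`. -/
def IsPfTransition (s : σ.FlAssign) (e : σ.ActAssign) (s' : σ.FlAssign) (p : σ.PfAssign) : Prop :=
  ∃ X ∈ (D.prog 1).SM, D.FlEq X 0 s ∧ D.ActEq X 0 e ∧ D.FlEq X 1 s' ∧ D.PfEq X 0 p

/-- At most one action constant is true in `e`. -/
def AtMostOne (e : σ.ActAssign) : Prop := ∀ a b, e a = true → e b = true → a = b

/-- No concurrency. -/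
def NoConcurrency : Prop := ∀ s e s', D.IsTransition s e s' → AtMostOne e

/-- Nondeterministic transitions are determined by pf constants. -/
def TransitionsDetermined : Prop :=
  ∀ s e p, D.IsState s → AtMostOne e → ∃! s', D.IsState s' ∧ D.IsPfTransition s e s' p

/-- Nondeterminism on initial states is determined by initpf constants
(`Tr(D, 0)` is `D_init ∪ D_0`). -/
def InitialDetermined : Prop :=
  ∀ q : σ.InitpfAssign, ∃! s : σ.FlAssign, ∃ X ∈ (D.Tr 0).SM, D.InitpfEq X q ∧ D.FlEq X 0 s

/-- The set of states. -/
def State : Type := {s : σ.FlAssign // D.IsState s}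

/-- The set of actions (including doing nothing). -/
def Action : Type := {e : σ.ActAssign // D.IsAction e}

noncomputable instance : Fintype D.State := by
  classical exact (inferInstance : Fintype {s : σ.FlAssign // D.IsState s})

/-- The formula `i : s`. -/
noncomputable def stateFormula (i : Fin (m + 1)) (s : D.State) : Formula (D.Atom m) :=
  conj fun c => atom (.fl i c (s.1 c))

/-- The formula `i : a`. -/
noncomputable def actionFormula (i : Fin m) (a : D.Action) : Formula (D.Atom m) :=
  conj fun c => atom (.act i c (a.1 c))

/-- `s` is consistent with `D_init`: some stable model of `D_init`, taken together with the program
`D_0` that generates the fluent values at time `0`, satisfies `0 : s`. -/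
def ConsistentInit (s : D.State) : Prop := ∃ X ∈ (D.Tr 0).SM, (D.stateFormula 0 s).Sat X

variable (m) in
/-- Non-stationary policies with the horizon `m`. -/
abbrev Policy : Type := D.State × Fin m → D.Action

/-- The formula `C_{π,m}`: the conjunction of `i : s → i : π(s, i)` over all states `s` and all
`i = 0, …, m-1`. -/
noncomputable def policyFormula (π : D.Policy m) : Formula (D.Atom m) :=
  conj fun x : D.State × Fin m =>
    imp (D.stateFormula x.2.castSucc x.1) (D.actionFormula x.2 (π x))

/-- The Markov decision process `M(D)`. -/
noncomputable def toMDP : MDP D.State D.Action where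
  T s a s' := (D.prog 1).condProb (D.stateFormula 1 s')
    ((D.stateFormula 0 s).and (D.actionFormula 0 a))
  R s a s' := (D.prog 1).expectedUtility
    (((D.stateFormula 0 s).and (D.actionFormula 0 a)).and (D.stateFormula 1 s'))
  T_mem _ _ _ := (D.prog 1).condProb_mem_Icc _ _

end ActionDescription

end PBC

/-!
The stable models of `D_m` and of `Tr(D, m)` are exactly the interpretations that consist of a
trajectory `s 0, e 0, p 0, s 1, …, s m` of fluent, action and pf assignments (with an initpf
assignment in the case of `Tr(D, m)`) and the entailed utility atoms, such that `s 0` is `Settled`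
and each `s (i + 1)` is a `Step` from `s i`, `e i`, `p i` (`mem_prog_SM`, `mem_Tr_SM`). The reason
is a splitting argument. A rule whose head the interpretation satisfies cannot fail in the reduct
as long as the atoms of its head are kept. Hence a counterexample to minimality at a single time
step is one for the whole program (`IsMinimal.graph_subset`), and conversely local minimality
gives minimality by induction on time (`isMinimal_interp`). A pf-transition is a single step, so
under the assumptions every state, action and pf assignment determine the next state
(`TransitionsDetermined.existsUnique_step`).

The weight of such a stable model is the product of the probabilities of its initpf values and of
its pf values, which factorizes over time. Summing out the pf values turns it into a product of the
numbers `stepProb s e s'`. For `m = 1` these are the transition probabilities of `M(D)` (`toMDP_T`),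
and where they do not vanish the rewards of `M(D)` are the sums of the utilities that a step earns
(`toMDP_R`). A condition `C_{π,m} ∧ 0 : s₀` fixes the initial state and all actions. The sum of the
weights that remain is the weight `initWeight s₀` of the initial state, because the trajectory
probabilities of a Markov chain sum to `1` (`sum_prod_kernel`). It is positive if `s₀` is consistent
with `D_init`, and it cancels in the conditional expectation, which leaves the expected total
reward of `π`.
-/

namespace PBC

/-! ### Satisfaction of reducts -/

namespace Formula

variable {α β : Type}

theorem sat_of_sat_reduct {I J : Set α} {F : Formula α} (h : (F.reduct I).Sat J) : F.Sat I := by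
  cases F with
  | bot => exact h
  | atom a =>
    by_contra hn
    have hn' : a ∉ I := hn
    simp [reduct, hn', Sat] at h
  | _ =>
    by_contra hn
    rw [reduct, if_neg hn] at h
    exact h

theorem sat_reduct_atom {I J : Set α} {a : α} :
    ((atom a).reduct I).Sat J ↔ a ∈ I ∧ a ∈ J := by
  by_cases h : a ∈ I <;> simp [reduct, h, Sat]

theorem sat_reduct_and {I J : Set α} {F G : Formula α} :
    ((F.and G).reduct I).Sat J ↔ (F.reduct I).Sat J ∧ (G.reduct I).Sat J := by
  by_cases h : (F.and G).Sat I
  · rw [reduct, if_pos h]; rfl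
  · rw [reduct, if_neg h]
    exact ⟨False.elim, fun h' => h ⟨sat_of_sat_reduct h'.1, sat_of_sat_reduct h'.2⟩⟩

theorem sat_reduct_or {I J : Set α} {F G : Formula α} :
    ((F.or G).reduct I).Sat J ↔ (F.reduct I).Sat J ∨ (G.reduct I).Sat J := by
  by_cases h : (F.or G).Sat I
  · rw [reduct, if_pos h]; rfl
  · rw [reduct, if_neg h]
    exact ⟨False.elim, fun h' => h (h'.imp sat_of_sat_reduct sat_of_sat_reduct)⟩

theorem sat_reduct_imp {I J : Set α} {F G : Formula α} :
    ((F.imp G).reduct I).Sat J ↔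
      (F.imp G).Sat I ∧ ((F.reduct I).Sat J → (G.reduct I).Sat J) := by
  by_cases h : (F.imp G).Sat I
  · rw [reduct, if_pos h]; exact ⟨fun h' => ⟨h, h'⟩, fun h' => h'.2⟩
  · rw [reduct, if_neg h]
    exact ⟨False.elim, fun h' => h h'.1⟩

theorem sat_reduct_self {I : Set α} {F : Formula α} : (F.reduct I).Sat I ↔ F.Sat I := by
  refine ⟨sat_of_sat_reduct, ?_⟩
  induction F with
  | bot => exact id
  | atom a => exact fun h => sat_reduct_atom.2 ⟨h, h⟩
  | and F G ihF ihG => exact fun h => sat_reduct_and.2 ⟨ihF h.1, ihG h.2⟩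
  | or F G ihF ihG => exact fun h => sat_reduct_or.2 (h.imp ihF ihG)
  | imp F G ihF ihG => exact fun h => sat_reduct_imp.2 ⟨h, fun h' => ihG (h (sat_of_sat_reduct h'))⟩

theorem sat_map {f : α → β} {I : Set β} {F : Formula α} : (F.map f).Sat I ↔ F.Sat (f ⁻¹' I) := by
  induction F with
  | bot => rfl
  | atom a => rfl
  | and F G ihF ihG => exact and_congr ihF ihG
  | or F G ihF ihG => exact or_congr ihF ihG
  | imp F G ihF ihG => exact imp_congr ihF ihG

theorem sat_reduct_map {f : α → β} {I J : Set β} {F : Formula α} :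
    ((F.map f).reduct I).Sat J ↔ (F.reduct (f ⁻¹' I)).Sat (f ⁻¹' J) := by
  induction F with
  | bot => rfl
  | atom a => rw [map, sat_reduct_atom, sat_reduct_atom]; rfl
  | and F G ihF ihG => rw [map, sat_reduct_and, sat_reduct_and, ihF, ihG]
  | or F G ihF ihG => rw [map, sat_reduct_or, sat_reduct_or, ihF, ihG]
  | imp F G ihF ihG =>
    rw [map, sat_reduct_imp, sat_reduct_imp, ihF, ihG]
    exact and_congr_left' (sat_map (F := F.imp G))

theorem sat_rule {I : Set α} {F G : Formula α} : (rule F G).Sat I ↔ (G.Sat I → F.Sat I) := Iff.rfl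

/-- A constraint `⊥ ← G` does not restrict the models of a reduct: once `I` satisfies it, its
reduct is satisfied by every set of atoms. -/
theorem sat_reduct_rule_bot {I J : Set α} {G : Formula α} :
    ((rule bot G).reduct I).Sat J ↔ (rule bot G).Sat I := by
  rw [rule, sat_reduct_imp]
  exact ⟨And.left, fun h => ⟨h, fun h' => h (sat_of_sat_reduct h')⟩⟩

/-- The reduct of `{a}^ch` fixes the truth value of `a`. -/
theorem sat_reduct_choice {I J : Set α} {a : α} :
    ((choice a).reduct I).Sat J ↔ (a ∈ I → a ∈ J) := by
  simp only [choice, rule, neg, sat_reduct_imp, sat_reduct_atom]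
  simp only [Sat, reduct]
  tauto

end Formula

open Formula

theorem Program.mem_SM_iff {α : Type} {P : Program α} {I : Set α} :
    I ∈ P.SM ↔ (∀ R ∈ P.hard, R.Sat I) ∧
      ∀ J ⊆ I, (∀ R ∈ P.hard, (R.reduct I).Sat J) →
        (∀ r ∈ P.soft, r.2.Sat I → (r.2.reduct I).Sat J) → I ⊆ J := by
  constructor
  · rintro ⟨⟨-, hmin⟩, hhard⟩
    refine ⟨hhard, fun J hJ h₁ h₂ => ?_⟩
    by_contra hn
    refine hmin J ⟨hJ, hn⟩ ?_
    rintro R ⟨hR | ⟨w, hR⟩, hs⟩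
    · exact h₁ R hR
    · exact h₂ _ hR hs
  · rintro ⟨hhard, hmin⟩
    refine ⟨⟨fun R hR => sat_reduct_self.2 hR.2, fun J hJ h => hJ.2 (hmin J hJ.1 ?_ ?_)⟩, hhard⟩
    · exact fun R hR => h R ⟨Or.inl hR, hhard R hR⟩
    · exact fun r hr hs => h r.2 ⟨Or.inr ⟨r.1, hr⟩, hs⟩

/-! ### Assignments as sets of atoms -/

/-- The set of the atoms `c = v` that the assignment `f` makes true. -/
def graph {ι : Type} {V : ι → Type} (f : ∀ c, V c) : Set (Σ c, V c) := {a | f a.1 = a.2}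

/-- The disjoint union of `A` and `B`. -/
def sumSet {α β : Type} (A : Set α) (B : Set β) : Set (α ⊕ β) := {x | Sum.elim (· ∈ A) (· ∈ B) x}

theorem sumElim_preimage {α β γ : Type} (f : α → γ) (g : β → γ) (X : Set γ) :
    Sum.elim f g ⁻¹' X = sumSet (f ⁻¹' X) (g ⁻¹' X) := by
  ext (x | x) <;> rfl

namespace ActionDescription

variable {σ : Signature} (D : ActionDescription σ) {m : ℕ}

/-- The set of the atoms `c = v` that the assignment `e` to the action constants makes true. -/
def actGraph (e : σ.ActAssign) : Set σ.ActAtom := {a | e a.1 = a.2}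

/-- The regular fluent atom `a`, as a fluent atom. -/
def regFl (a : σ.RegAtom) : σ.FlAtom := ⟨a.1.1, a.2⟩

/-- The utility law `l` yields its reward in the step from `s` to `s'` by the action `e`. -/
def Rewarded (l : UtilityLaw σ) (s : σ.FlAssign) (e : σ.ActAssign) (s' : σ.FlAssign) : Prop :=
  l.body.Sat (graph s') ∧ l.pre.Sat (sumSet (graph s) (actGraph e))

/-- The interpretation that is `i : s i`, `i : e i`, `i : p i` on the fluent, action and pf atoms,
whose initpf atoms are those in `q`, and whose utility atoms are the ones entailed. -/
def interp (q : Set σ.InitpfAtom) (s : Fin (m + 1) → σ.FlAssign) (e : Fin m → σ.ActAssign)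
    (p : Fin m → σ.PfAssign) : Set (D.Atom m) :=
  {a | match a with
    | .fl i c v => s i c = v
    | .act i c v => e i c = v
    | .pf i c v => p i c = v
    | .initpf c v => ⟨c, v⟩ ∈ q
    | .utility l i => Rewarded l.1 (s i.castSucc) (e i) (s i.succ)}

/-- The fluent assignment `s` satisfies the static laws. -/
def StaticSat (s : σ.FlAssign) : Prop :=
  ∀ l ∈ D.staticLaws, l.body.Sat (graph s) → l.head.Sat (graph s)

/-- The set `J` of fluent atoms satisfies the reduct of the static laws relative to `s`. -/
def StaticReduct (s : σ.FlAssign) (J : Set σ.FlAtom) : Prop :=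
  ∀ l ∈ D.staticLaws, (l.body.reduct (graph s)).Sat J → (l.head.reduct (graph s)).Sat J

/-- The pair of the fluent assignments `s`, `s'` satisfies the dynamic laws under `e` and `p`. -/
def DynamicSat (s : σ.FlAssign) (e : σ.ActAssign) (p : σ.PfAssign) (s' : σ.FlAssign) : Prop :=
  ∀ l ∈ D.dynamicLaws, l.body.Sat (graph s') →
    l.pre.Sat (sumSet (graph s) (sumSet (actGraph e) (graph p))) →
      l.head.Sat (regFl ⁻¹' graph s')

/-- The set `J` of fluent atoms satisfies the reduct, relative to `s'`, of what the dynamic laws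
become when `s`, `e` and `p` are substituted into the formulas after the keyword `after`. -/
def DynamicReduct (s : σ.FlAssign) (e : σ.ActAssign) (p : σ.PfAssign) (s' : σ.FlAssign)
    (J : Set σ.FlAtom) : Prop :=
  ∀ l ∈ D.dynamicLaws, (l.body.reduct (graph s')).Sat J →
    l.pre.Sat (sumSet (graph s) (sumSet (actGraph e) (graph p))) →
      (l.head.reduct (regFl ⁻¹' graph s')).Sat (regFl ⁻¹' J)

/-- `s` is stable with respect to the static laws and the choice rules for the regular fluent
constants. This is the condition that `D_m` puts on the fluents at time `0`. -/
def Settled (s : σ.FlAssign) : Prop :=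
  D.StaticSat s ∧ ∀ J ⊆ graph s, (∀ a : σ.RegAtom, regFl a ∈ graph s → regFl a ∈ J) →
    D.StaticReduct s J → graph s ⊆ J

/-- `s'` is stable with respect to the static and the dynamic laws, given that the preceding state,
action and pf values are `s`, `e` and `p`. This is the condition that `D_m` puts on the fluents at
time `i + 1`. -/
def Step (s : σ.FlAssign) (e : σ.ActAssign) (p : σ.PfAssign) (s' : σ.FlAssign) : Prop :=
  D.StaticSat s' ∧ D.DynamicSat s e p s' ∧
    ∀ J ⊆ graph s', D.StaticReduct s' J → D.DynamicReduct s e p s' J → graph s' ⊆ J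

/-- A successor is again a state: the heads of the dynamic laws contain regular constants only,
so at a set `J` that keeps the regular atoms their reducts hold. -/
theorem Step.settled {D : ActionDescription σ} {s : σ.FlAssign} {e : σ.ActAssign}
    {p : σ.PfAssign} {s' : σ.FlAssign} (h : D.Step s e p s') : D.Settled s' := by
  refine ⟨h.1, fun J hJ hreg hst => h.2.2 J hJ hst fun l hl hb hp => ?_⟩
  have hJ' : regFl ⁻¹' J = regFl ⁻¹' graph s' :=
    Set.Subset.antisymm (fun a ha => hJ ha) fun a ha => hreg a ha
  rw [hJ', sat_reduct_self]
  exact h.2.1 l hl (sat_of_sat_reduct hb) hp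

/-! ### Models of the hard rules and of their reducts -/

/-- `X` satisfies the static, dynamic and utility rules of `D_m`. -/
structure LawModel (X : Set (D.Atom m)) : Prop where
  static : ∀ l ∈ D.staticLaws, ∀ i, l.body.Sat (D.flAt i ⁻¹' X) → l.head.Sat (D.flAt i ⁻¹' X)
  dynamic : ∀ l ∈ D.dynamicLaws, ∀ i : Fin m, l.body.Sat (D.flAt i.succ ⁻¹' X) →
    l.pre.Sat (sumSet (D.flAt i.castSucc ⁻¹' X) (sumSet (D.actAt i ⁻¹' X) (D.pfAt i ⁻¹' X))) →
      l.head.Sat (D.regAt i.succ ⁻¹' X)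
  utility : ∀ (l : {l : UtilityLaw σ // l ∈ D.utilityLaws}) (i : Fin m),
    l.1.body.Sat (D.flAt i.succ ⁻¹' X) →
      l.1.pre.Sat (sumSet (D.flAt i.castSucc ⁻¹' X) (D.actAt i ⁻¹' X)) → Atom.utility l i ∈ X

/-- `J` satisfies the reducts relative to `X` of the hard rules of `D_m`, provided that `X`
satisfies these rules. -/
structure ReductModel (X J : Set (D.Atom m)) : Prop where
  static : ∀ l ∈ D.staticLaws, ∀ i, (l.body.reduct (D.flAt i ⁻¹' X)).Sat (D.flAt i ⁻¹' J) →
    (l.head.reduct (D.flAt i ⁻¹' X)).Sat (D.flAt i ⁻¹' J)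
  dynamic : ∀ l ∈ D.dynamicLaws, ∀ i : Fin m,
    (l.body.reduct (D.flAt i.succ ⁻¹' X)).Sat (D.flAt i.succ ⁻¹' J) →
      (l.pre.reduct
        (sumSet (D.flAt i.castSucc ⁻¹' X) (sumSet (D.actAt i ⁻¹' X) (D.pfAt i ⁻¹' X)))).Sat
        (sumSet (D.flAt i.castSucc ⁻¹' J) (sumSet (D.actAt i ⁻¹' J) (D.pfAt i ⁻¹' J))) →
      (l.head.reduct (D.regAt i.succ ⁻¹' X)).Sat (D.regAt i.succ ⁻¹' J)
  utility : ∀ (l : {l : UtilityLaw σ // l ∈ D.utilityLaws}) (i : Fin m),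
    (l.1.body.reduct (D.flAt i.succ ⁻¹' X)).Sat (D.flAt i.succ ⁻¹' J) →
      (l.1.pre.reduct (sumSet (D.flAt i.castSucc ⁻¹' X) (D.actAt i ⁻¹' X))).Sat
        (sumSet (D.flAt i.castSucc ⁻¹' J) (D.actAt i ⁻¹' J)) → Atom.utility l i ∈ J
  reg : ∀ a : σ.RegAtom, D.regAt 0 a ∈ X → D.regAt 0 a ∈ J
  act : ∀ (i : Fin m) (a : σ.ActAtom), D.actAt i a ∈ X → D.actAt i a ∈ J

theorem sat_valueConstraints {V : Type} [Fintype V] {f : V → D.Atom m} {X : Set (D.Atom m)} :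
    (∀ R ∈ D.valueConstraints f, R.Sat X) ↔ ∃ v, ∀ w, f w ∈ X ↔ v = w := by
  constructor
  · intro h
    have h₁ := h _ (Or.inr rfl)
    have h₂ : ∃ v, f v ∈ X := by
      by_contra hn
      refine h₁ fun h' => hn ?_
      exact (sat_disj X _).1 h'
    obtain ⟨v, hv⟩ := h₂
    refine ⟨v, fun w => ⟨fun hw => ?_, fun hw => hw ▸ hv⟩⟩
    by_contra hne
    exact h _ (Or.inl ⟨v, w, hne, rfl⟩) ⟨hv, hw⟩
  · rintro ⟨v, hv⟩ R (⟨w, w', hne, rfl⟩ | rfl)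
    · exact fun h => hne (((hv w).1 h.1).symm.trans ((hv w').1 h.2))
    · exact fun h => h ((sat_disj X _).2 ⟨v, (hv v).2 rfl⟩)

theorem sat_reduct_of_mem_valueConstraints {V : Type} [Fintype V] {f : V → D.Atom m}
    {X J : Set (D.Atom m)} {R : Formula (D.Atom m)} (hR : R ∈ D.valueConstraints f)
    (h : R.Sat X) : (R.reduct X).Sat J := by
  obtain ⟨w, w', -, rfl⟩ | rfl := hR <;> exact sat_reduct_rule_bot.2 h

theorem forall_mem_prog_hard {p : Formula (D.Atom m) → Prop} :
    (∀ R ∈ (D.prog m).hard, p R) ↔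
      (∀ R ∈ D.staticRules m, p R) ∧ (∀ R ∈ D.dynamicRules m, p R) ∧
      (∀ R ∈ D.utilityRules m, p R) ∧ (∀ R ∈ D.choiceRules m, p R) ∧
      (∀ i c, ∀ R ∈ D.valueConstraints (Atom.fl (m := m) i c), p R) ∧
      (∀ i c, ∀ R ∈ D.valueConstraints (Atom.act (m := m) i c), p R) ∧
      (∀ i c, ∀ R ∈ D.valueConstraints (Atom.pf (m := m) i c), p R) := by
  simp only [prog, Set.mem_union, Set.mem_iUnion, or_imp, forall_and, forall_exists_index, and_assoc]
  refine and_congr_right' (and_congr_right' (and_congr_right' (and_congr_right'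
    (and_congr ?_ (and_congr ?_ ?_))))) <;>
  exact ⟨fun h i c R => h R i c, fun h R i c => h i c R⟩

theorem sat_prog_hard {X : Set (D.Atom m)} :
    (∀ R ∈ (D.prog m).hard, R.Sat X) ↔ D.LawModel X ∧
      ∃ (s : Fin (m + 1) → σ.FlAssign) (e : Fin m → σ.ActAssign) (p : Fin m → σ.PfAssign),
        (∀ i, D.FlEq X i (s i)) ∧ (∀ i, D.ActEq X i (e i)) ∧ ∀ i, D.PfEq X i (p i) := by
  rw [forall_mem_prog_hard]
  simp only [sat_valueConstraints]
  constructor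
  · rintro ⟨h₁, h₂, h₃, -, hf, ha, hp⟩
    refine ⟨⟨?_, ?_, ?_⟩, ?_⟩
    · intro l hl i
      simpa only [sat_rule, sat_map] using h₁ _ ⟨l, hl, i, rfl⟩
    · intro l hl i hb hp
      have := h₂ _ ⟨l, hl, i, rfl⟩
      simp only [sat_rule, Sat, sat_map, sumElim_preimage] at this
      exact this ⟨hb, hp⟩
    · intro l i hb hp
      have := h₃ _ ⟨l, i, rfl⟩
      simp only [sat_rule, Sat, sat_map, sumElim_preimage] at this
      exact this ⟨hb, hp⟩
    · choose s hs using hf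
      choose e he using ha
      choose p hp using hp
      exact ⟨s, e, p, hs, he, hp⟩
  · rintro ⟨h, s, e, p, hs, he, hp⟩
    refine ⟨?_, ?_, ?_, ?_, fun i c => ⟨s i c, hs i c⟩, fun i c => ⟨e i c, he i c⟩,
      fun i c => ⟨p i c, hp i c⟩⟩
    · rintro R ⟨l, hl, i, rfl⟩
      simpa only [sat_rule, sat_map] using h.static l hl i
    · rintro R ⟨l, hl, i, rfl⟩
      simp only [sat_rule, Sat, sat_map, sumElim_preimage]
      exact fun hh => h.dynamic l hl i hh.1 hh.2
    · rintro R ⟨l, i, rfl⟩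
      simp only [sat_rule, Sat, sat_map, sumElim_preimage]
      exact fun hh => h.utility l i hh.1 hh.2
    · rintro R (⟨a, rfl⟩ | ⟨i, a, rfl⟩) <;> exact fun hh => by_contra fun hn => hh hn

theorem sat_reduct_prog_hard {X J : Set (D.Atom m)} (hX : ∀ R ∈ (D.prog m).hard, R.Sat X) :
    (∀ R ∈ (D.prog m).hard, (R.reduct X).Sat J) ↔ D.ReductModel X J := by
  have hL := (D.sat_prog_hard.1 hX).1
  have hX' := D.forall_mem_prog_hard.1 hX
  rw [forall_mem_prog_hard]
  constructor
  · rintro ⟨h₁, h₂, h₃, h₄, -⟩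
    refine ⟨?_, ?_, ?_, ?_, ?_⟩
    · intro l hl i
      have := h₁ _ ⟨l, hl, i, rfl⟩
      rw [rule, sat_reduct_imp] at this
      simpa only [sat_reduct_map] using this.2
    · intro l hl i hb hp
      have := h₂ _ ⟨l, hl, i, rfl⟩
      rw [rule, sat_reduct_imp] at this
      simp only [sat_reduct_and, sat_reduct_map, sumElim_preimage] at this
      exact this.2 ⟨hb, hp⟩
    · intro l i hb hp
      have := h₃ _ ⟨l, i, rfl⟩
      rw [rule, sat_reduct_imp] at this
      simp only [sat_reduct_and, sat_reduct_map, sumElim_preimage, sat_reduct_atom] at this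
      exact (this.2 ⟨hb, hp⟩).2
    · exact fun a => sat_reduct_choice.1 (h₄ _ (Or.inl ⟨a, rfl⟩))
    · exact fun i a => sat_reduct_choice.1 (h₄ _ (Or.inr ⟨i, a, rfl⟩))
  · intro h
    refine ⟨?_, ?_, ?_, ?_, ?_, ?_, ?_⟩
    · rintro R ⟨l, hl, i, rfl⟩
      rw [rule, sat_reduct_imp]
      refine ⟨hX'.1 _ ⟨l, hl, i, rfl⟩, ?_⟩
      simpa only [sat_reduct_map] using h.static l hl i
    · rintro R ⟨l, hl, i, rfl⟩
      rw [rule, sat_reduct_imp]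
      refine ⟨hX'.2.1 _ ⟨l, hl, i, rfl⟩, ?_⟩
      simp only [sat_reduct_and, sat_reduct_map, sumElim_preimage]
      exact fun hh => h.dynamic l hl i hh.1 hh.2
    · rintro R ⟨l, i, rfl⟩
      rw [rule, sat_reduct_imp]
      refine ⟨hX'.2.2.1 _ ⟨l, i, rfl⟩, ?_⟩
      simp only [sat_reduct_and, sat_reduct_map, sumElim_preimage, sat_reduct_atom]
      exact fun hh => ⟨hL.utility l i (sat_of_sat_reduct hh.1) (sat_of_sat_reduct hh.2),
        h.utility l i hh.1 hh.2⟩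
    · rintro R (⟨a, rfl⟩ | ⟨i, a, rfl⟩)
      · exact sat_reduct_choice.2 (h.reg a)
      · exact sat_reduct_choice.2 (h.act i a)
    · exact fun i c R hR => D.sat_reduct_of_mem_valueConstraints hR (hX'.2.2.2.2.1 i c R hR)
    · exact fun i c R hR => D.sat_reduct_of_mem_valueConstraints hR (hX'.2.2.2.2.2.1 i c R hR)
    · exact fun i c R hR => D.sat_reduct_of_mem_valueConstraints hR (hX'.2.2.2.2.2.2 i c R hR)

/-! ### Splitting stable models into time steps -/

/-- The minimality condition that makes a model `X` of the hard rules of `D_m` a stable model: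
`X` has no proper subset that satisfies the reducts of the hard rules and contains the pf atoms of
`X` as well as the initpf atoms in `E`. -/
def IsMinimal (E : Set σ.InitpfAtom) (X : Set (D.Atom m)) : Prop :=
  ∀ J ⊆ X, D.ReductModel X J → (∀ i a, D.pfAt i a ∈ X → D.pfAt i a ∈ J) →
    (∀ a ∈ E, D.initpfAt a ∈ J) → X ⊆ J

variable {D}

theorem LawModel.reductModel_self {X : Set (D.Atom m)} (h : D.LawModel X) :
    D.ReductModel X X where
  static l hl i hb := sat_reduct_self.2 (h.static l hl i (sat_of_sat_reduct hb))
  dynamic l hl i hb hp :=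
    sat_reduct_self.2 (h.dynamic l hl i (sat_of_sat_reduct hb) (sat_of_sat_reduct hp))
  utility l i hb hp := h.utility l i (sat_of_sat_reduct hb) (sat_of_sat_reduct hp)
  reg _ := id
  act _ _ := id

/-- In a minimal model every utility atom is entailed, as otherwise it could be removed. -/
theorem IsMinimal.eq_interp {E : Set σ.InitpfAtom} {X : Set (D.Atom m)} (h : D.IsMinimal E X)
    (hL : D.LawModel X) {s : Fin (m + 1) → σ.FlAssign} {e : Fin m → σ.ActAssign}
    {p : Fin m → σ.PfAssign} (hs : ∀ i, D.FlEq X i (s i)) (he : ∀ i, D.ActEq X i (e i))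
    (hp : ∀ i, D.PfEq X i (p i)) (hE : E ⊆ D.initpfAt ⁻¹' X) :
    X = D.interp (D.initpfAt ⁻¹' X) s e p := by
  have hs' : ∀ i, D.flAt i ⁻¹' X = graph (s i) := fun i => Set.ext fun a => hs i a.1 a.2
  have he' : ∀ i, D.actAt i ⁻¹' X = actGraph (e i) := fun i => Set.ext fun a => he i a.1 a.2
  ext a
  cases a with
  | fl i c v => exact hs i c v
  | act i c v => exact he i c v
  | pf i c v => exact hp i c v
  | initpf c v => exact Iff.rfl
  | utility l i =>
    change _ ↔ Rewarded l.1 _ _ _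
    constructor
    · intro ha
      by_contra hn
      have hR := hL.reductModel_self
      have hfl : ∀ j, D.flAt j ⁻¹' (X \ {Atom.utility l i}) = D.flAt j ⁻¹' X := fun j =>
        Set.ext fun a => ⟨fun h => h.1, fun h => ⟨h, fun h' => by cases h'⟩⟩
      have hact : ∀ j, D.actAt j ⁻¹' (X \ {Atom.utility l i}) = D.actAt j ⁻¹' X := fun j =>
        Set.ext fun a => ⟨fun h => h.1, fun h => ⟨h, fun h' => by cases h'⟩⟩
      have hpf : ∀ j, D.pfAt j ⁻¹' (X \ {Atom.utility l i}) = D.pfAt j ⁻¹' X := fun j =>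
        Set.ext fun a => ⟨fun h => h.1, fun h => ⟨h, fun h' => by cases h'⟩⟩
      have hreg : ∀ j, D.regAt j ⁻¹' (X \ {Atom.utility l i}) = D.regAt j ⁻¹' X := fun j =>
        Set.ext fun a => ⟨fun h => h.1, fun h => ⟨h, fun h' => by cases h'⟩⟩
      refine (h (X \ {Atom.utility l i}) Set.sdiff_subset ⟨?_, ?_, ?_, ?_, ?_⟩ ?_ ?_ ha).2 rfl
      · simpa only [hfl] using hR.static
      · simpa only [hfl, hact, hpf, hreg] using hR.dynamic
      · intro l' i' hb hg
        rw [hfl] at hb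
        rw [hfl, hact] at hg
        refine ⟨hR.utility l' i' hb hg, fun heq => ?_⟩
        cases heq
        rw [hs', sat_reduct_self] at hb
        rw [hs', he', sat_reduct_self] at hg
        exact hn ⟨hb, hg⟩
      · exact fun a ha => ⟨ha, fun h' => by cases h'⟩
      · exact fun i a ha => ⟨ha, fun h' => by cases h'⟩
      · exact fun i a ha => ⟨ha, fun h' => by cases h'⟩
      · exact fun a ha => ⟨hE ha, fun h' => by cases h'⟩
    · rintro ⟨hb, hg⟩
      refine hL.utility l i ?_ ?_
      · rwa [hs']
      · rwa [hs', he']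

theorem lawModel_interp {q : Set σ.InitpfAtom} {s : Fin (m + 1) → σ.FlAssign}
    {e : Fin m → σ.ActAssign} {p : Fin m → σ.PfAssign} :
    D.LawModel (D.interp q s e p) ↔ (∀ i, D.StaticSat (s i)) ∧
      ∀ i : Fin m, D.DynamicSat (s i.castSucc) (e i) (p i) (s i.succ) :=
  ⟨fun h => ⟨fun i l hl => h.static l hl i, fun i l hl => h.dynamic l hl i⟩,
    fun h => ⟨fun l hl i => h.1 i l hl, fun l hl i => h.2 i l hl, fun _ _ hb hg => ⟨hb, hg⟩⟩⟩

/-- The interpretation `X`, with its fluent atoms at time `k` replaced by those in `K`. -/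
def replaceFl (X : Set (D.Atom m)) (k : Fin (m + 1)) (K : Set σ.FlAtom) : Set (D.Atom m) :=
  {a | match a with
    | .fl i c v => if i = k then ⟨c, v⟩ ∈ K else Atom.fl i c v ∈ X
    | a => a ∈ X}

/-- Shrinking a single time step: if the smaller set `K` satisfies the reducts of the rules whose
heads are about the fluents at time `k`, then all hard rules hold in the reduct. The rules with
other heads hold because the interpretation itself satisfies these heads. -/
theorem IsMinimal.graph_subset {E q : Set σ.InitpfAtom} {s : Fin (m + 1) → σ.FlAssign}
    {e : Fin m → σ.ActAssign} {p : Fin m → σ.PfAssign}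
    (h : D.IsMinimal E (D.interp q s e p)) (hL : D.LawModel (D.interp q s e p)) (hE : E ⊆ q)
    {k : Fin (m + 1)} {K : Set σ.FlAtom} (hK : K ⊆ graph (s k)) (hst : D.StaticReduct (s k) K)
    (hdyn : ∀ i : Fin m, i.succ = k → D.DynamicReduct (s i.castSucc) (e i) (p i) (s i.succ) K)
    (hreg : k = 0 → ∀ a : σ.RegAtom, regFl a ∈ graph (s k) → regFl a ∈ K) :
    graph (s k) ⊆ K := by
  set X := D.interp q s e p with hX
  have hself : D.flAt k ⁻¹' replaceFl X k K = K := Set.ext fun a => by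
    change (if k = k then _ else _) ↔ _
    rw [if_pos rfl]
  have hother : ∀ i, i ≠ k → D.flAt i ⁻¹' replaceFl X k K = graph (s i) := fun i hi =>
    Set.ext fun a => by
      change (if i = k then _ else _) ↔ _
      rw [if_neg hi]; rfl
  have hsub : replaceFl X k K ⊆ X := by
    intro a ha
    cases a with
    | fl i c v =>
      change if i = k then _ else _ at ha
      split_ifs at ha with hi
      · subst hi; exact hK ha
      · exact ha
    | _ => exact ha
  have key : X ⊆ replaceFl X k K := by
    refine h _ hsub ⟨?_, ?_, ?_, ?_, ?_⟩ ?_ ?_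
    · intro l hl i hb
      by_cases hi : i = k
      · subst hi
        rw [hself] at hb ⊢
        exact hst l hl hb
      · rw [hother i hi]
        exact sat_reduct_self.2 (hL.static l hl i (sat_of_sat_reduct hb))
    · intro l hl i hb hp
      by_cases hi : i.succ = k
      · subst hi
        rw [hself] at hb
        change (l.head.reduct _).Sat (regFl ⁻¹' (D.flAt i.succ ⁻¹' replaceFl X i.succ K))
        rw [hself]
        exact hdyn i rfl l hl hb (sat_of_sat_reduct hp)
      · change (l.head.reduct _).Sat (regFl ⁻¹' (D.flAt i.succ ⁻¹' replaceFl X k K))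
        rw [hother _ hi]
        exact sat_reduct_self.2
          (hL.dynamic l hl i (sat_of_sat_reduct hb) (sat_of_sat_reduct hp))
    · intro l i hb hp
      exact hL.utility l i (sat_of_sat_reduct hb) (sat_of_sat_reduct hp)
    · intro a ha
      change regFl a ∈ D.flAt 0 ⁻¹' replaceFl X k K
      by_cases hk : 0 = k
      · subst hk
        rw [hself]
        exact hreg rfl a ha
      · rw [hother 0 hk]
        exact ha
    · exact fun _ _ ha => ha
    · exact fun _ _ ha => ha
    · exact fun _ ha => hE ha
  intro a ha
  have := key (show D.flAt k a ∈ X from ha)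
  rw [← hself]
  exact this

/-- Splitting along time: a model of the laws is minimal if and only if its fluents at time `0` are
settled and every time step is stable given the preceding one. -/
theorem isMinimal_interp {E q : Set σ.InitpfAtom} {s : Fin (m + 1) → σ.FlAssign}
    {e : Fin m → σ.ActAssign} {p : Fin m → σ.PfAssign} (hE : E ⊆ q) :
    D.LawModel (D.interp q s e p) ∧ D.IsMinimal E (D.interp q s e p) ↔
      q = E ∧ D.Settled (s 0) ∧ ∀ i : Fin m, D.Step (s i.castSucc) (e i) (p i) (s i.succ) := by
  constructor
  · rintro ⟨hL, h⟩
    have hL' := lawModel_interp.1 hL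
    refine ⟨Set.Subset.antisymm ?_ hE, ⟨hL'.1 0, fun J hJ hreg hst => ?_⟩,
      fun i => ⟨hL'.1 _, hL'.2 i, fun J hJ hst hdyn => ?_⟩⟩
    · -- The initpf atoms occur in no head, so those outside `E` can be removed.
      have hR := hL.reductModel_self
      have := h {a | a ∈ D.interp q s e p ∧ ∀ c v, a = Atom.initpf c v → ⟨c, v⟩ ∈ E}
        (fun a ha => ha.1) ?_ (fun i a ha => ⟨ha, fun c v h => by cases h⟩)
        (fun a ha => ⟨hE ha, fun c v h => by cases h; exact ha⟩)
      · exact fun a ha => (this (show D.initpfAt a ∈ _ from ha)).2 a.1 a.2 rfl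
      · have hfl : ∀ j, D.flAt j ⁻¹' {a | a ∈ D.interp q s e p ∧
            ∀ c v, a = Atom.initpf c v → ⟨c, v⟩ ∈ E} = D.flAt j ⁻¹' D.interp q s e p := fun j =>
          Set.ext fun a => ⟨fun h => h.1, fun h => ⟨h, fun c v h' => by cases h'⟩⟩
        refine ⟨?_, ?_, ?_, ?_, ?_⟩
        · simpa only [hfl] using hR.static
        · intro l hl i hb hp
          exact (congrArg (fun Y => (l.head.reduct _).Sat (regFl ⁻¹' Y)) (hfl i.succ)).mpr
            (sat_reduct_self.2
              (hL.dynamic l hl i (sat_of_sat_reduct hb) (sat_of_sat_reduct hp)))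
        · exact fun l i hb hp => ⟨hL.utility l i (sat_of_sat_reduct hb) (sat_of_sat_reduct hp),
            fun c v h' => by cases h'⟩
        · exact fun a ha => ⟨ha, fun c v h' => by cases h'⟩
        · exact fun i a ha => ⟨ha, fun c v h' => by cases h'⟩
    · exact h.graph_subset hL hE hJ hst (fun i hi => absurd hi i.succ_ne_zero) fun _ => hreg
    · refine h.graph_subset hL hE hJ hst (fun j hj => ?_) fun hk => absurd hk i.succ_ne_zero
      obtain rfl := Fin.succ_injective _ hj
      exact hdyn
  · rintro ⟨rfl, h₀, hstep⟩
    refine ⟨lawModel_interp.2 ⟨fun i => ?_, fun i => (hstep i).2.1⟩, ?_⟩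
    · induction i using Fin.cases with
      | zero => exact h₀.1
      | succ i => exact (hstep i).1
    intro J hJ hR hpf hq
    have hact : ∀ i, D.actAt i ⁻¹' J = actGraph (e i) := fun i =>
      Set.Subset.antisymm (fun a ha => hJ ha) fun a ha => hR.act i a ha
    have hpf' : ∀ i, D.pfAt i ⁻¹' J = graph (p i) := fun i =>
      Set.Subset.antisymm (fun a ha => hJ ha) fun a ha => hpf i a ha
    have hfl : ∀ i, D.flAt i ⁻¹' J = graph (s i) := by
      intro i
      refine Set.Subset.antisymm (fun a ha => hJ ha) ?_
      induction i using Fin.induction with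
      | zero =>
        exact h₀.2 (D.flAt 0 ⁻¹' J) (fun a ha => hJ ha) (fun a ha => hR.reg a ha)
          fun l hl => hR.static l hl 0
      | succ i ih =>
        have hi : D.flAt i.castSucc ⁻¹' J = graph (s i.castSucc) :=
          Set.Subset.antisymm (fun a ha => hJ ha) ih
        refine (hstep i).2.2 (D.flAt i.succ ⁻¹' J) (fun a ha => hJ ha) (fun l hl => hR.static l hl _)
          fun l hl hb hp => hR.dynamic l hl i hb ?_
        rw [hi, hact, hpf']
        exact sat_reduct_self.2 hp
    intro a ha
    cases a with
    | fl i c v => exact (hfl i).ge (show (⟨c, v⟩ : σ.FlAtom) ∈ graph (s i) from ha)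
    | act i c v => exact hR.act i (c, v) ha
    | pf i c v => exact hpf i ⟨c, v⟩ ha
    | initpf c v => exact hq ⟨c, v⟩ ha
    | utility l i =>
      refine hR.utility l i ?_ ?_
      · rw [hfl]; exact sat_reduct_self.2 ha.1
      · rw [hfl, hact]; exact sat_reduct_self.2 ha.2

theorem flEq_interp {q : Set σ.InitpfAtom} {s : Fin (m + 1) → σ.FlAssign}
    {e : Fin m → σ.ActAssign} {p : Fin m → σ.PfAssign} (i : Fin (m + 1)) :
    D.FlEq (D.interp q s e p) i (s i) := fun _ _ => Iff.rfl

theorem hard_isMinimal_iff {E : Set σ.InitpfAtom} {X : Set (D.Atom m)}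
    (hE : E ⊆ D.initpfAt ⁻¹' X) :
    (∀ R ∈ (D.prog m).hard, R.Sat X) ∧ D.IsMinimal E X ↔
      ∃ s e p, X = D.interp E s e p ∧ D.Settled (s 0) ∧
        ∀ i : Fin m, D.Step (s i.castSucc) (e i) (p i) (s i.succ) := by
  rw [sat_prog_hard]
  constructor
  · rintro ⟨⟨hL, s, e, p, hs, he, hp⟩, hmin⟩
    have hX := hmin.eq_interp hL hs he hp hE
    have := (isMinimal_interp (s := s) (e := e) (p := p) hE).1 ⟨hX ▸ hL, hX ▸ hmin⟩
    exact ⟨s, e, p, by rw [← this.1]; exact hX, this.2⟩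
  · rintro ⟨s, e, p, rfl, h⟩
    have := (isMinimal_interp (s := s) (e := e) (p := p) (le_refl E)).2 ⟨rfl, h⟩
    exact ⟨⟨this.1, s, e, p, fun _ _ _ => Iff.rfl, fun _ _ _ => Iff.rfl, fun _ _ _ => Iff.rfl⟩,
      this.2⟩

theorem mem_prog_soft {r : ℝ × Formula (D.Atom m)} :
    r ∈ (D.prog m).soft ↔
      ∃ i a, r = (Real.log (D.pfProb a.1 a.2), atom (D.pfAt i a)) := by
  simp only [prog, Finset.mem_image, Finset.mem_univ, true_and, Prod.exists, eq_comm]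

theorem mem_initProg_soft {r : ℝ × Formula (D.Atom m)} :
    r ∈ (D.initProg m).soft ↔
      ∃ a, r = (Real.log (D.initpfProb a.1 a.2), atom (D.initpfAt a)) := by
  simp only [initProg, Finset.mem_image, Finset.mem_univ, true_and, eq_comm]

theorem mem_prog_SM {X : Set (D.Atom m)} :
    X ∈ (D.prog m).SM ↔ ∃ s e p, X = D.interp ∅ s e p ∧ D.Settled (s 0) ∧
      ∀ i : Fin m, D.Step (s i.castSucc) (e i) (p i) (s i.succ) := by
  rw [← hard_isMinimal_iff (Set.empty_subset _), Program.mem_SM_iff]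
  refine and_congr_right fun hX => forall_congr' fun J => forall_congr' fun hJ => ?_
  rw [D.sat_reduct_prog_hard hX]
  refine forall_congr' fun _ => ?_
  constructor
  · intro h h₁ _
    refine h fun r hr hs => ?_
    obtain ⟨i, a, rfl⟩ := mem_prog_soft.1 hr
    exact sat_reduct_atom.2 ⟨hs, h₁ i a hs⟩
  · intro h h₁
    refine h (fun i a ha => ?_) (by simp)
    exact (sat_reduct_atom.1 (h₁ _ (mem_prog_soft.2 ⟨i, a, rfl⟩) ha)).2

variable (D) in
/-- The initial static laws hold for the initpf assignment `q` and the fluent assignment `s`. -/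
def InitSat (q : σ.InitpfAssign) (s : σ.FlAssign) : Prop :=
  ∀ l ∈ D.initialLaws, l.body.Sat (sumSet (graph s) (graph q)) → l.head.Sat (graph s)

theorem sat_initProg_hard {X : Set (D.Atom m)} {s : σ.FlAssign} (hs : D.FlEq X 0 s) :
    (∀ R ∈ (D.initProg m).hard, R.Sat X) ↔ ∃ q, D.InitpfEq X q ∧ D.InitSat q s := by
  have hfl : D.flAt 0 ⁻¹' X = graph s := Set.ext fun a => hs a.1 a.2
  have hinit : ∀ {q}, D.InitpfEq X q → D.initpfAt ⁻¹' X = graph q :=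
    fun hq => Set.ext fun a => hq a.1 a.2
  have hrule : ∀ (l : InitialLaw σ) {q}, D.InitpfEq X q →
      ((rule bot ((neg (l.head.map (D.flAt 0))).and
        (l.body.map (Sum.elim (D.flAt 0) D.initpfAt)))).Sat X ↔
      (l.body.Sat (sumSet (graph s) (graph q)) → l.head.Sat (graph s))) := by
    intro l q hq
    simp only [sat_rule, neg, Sat, sat_map, sumElim_preimage, hfl, hinit hq]
    tauto
  have hvc : ∀ c, ∀ R ∈ D.valueConstraints (Atom.fl (m := m) 0 c), R.Sat X := fun c =>
    D.sat_valueConstraints.2 ⟨s c, hs c⟩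
  simp only [initProg, Set.mem_union, Set.mem_iUnion]
  constructor
  · intro h
    have hq : ∀ c, ∃ v, ∀ w, Atom.initpf c w ∈ X ↔ v = w := fun c =>
      D.sat_valueConstraints.1 fun R hR => h R (Or.inl (Or.inr ⟨c, hR⟩))
    choose q hq using hq
    exact ⟨q, hq, fun l hl => (hrule l hq).1 (h _ (Or.inl (Or.inl ⟨l, hl, rfl⟩)))⟩
  · rintro ⟨q, hq, hI⟩ R ((⟨l, hl, rfl⟩ | ⟨c, hR⟩) | ⟨c, hR⟩)
    · exact (hrule l hq).2 (hI l hl)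
    · exact D.sat_valueConstraints.2 ⟨q c, hq c⟩ R hR
    · exact hvc c R hR

theorem sat_reduct_of_mem_initProg_hard {X J : Set (D.Atom m)} {R : Formula (D.Atom m)}
    (hR : R ∈ (D.initProg m).hard) (h : R.Sat X) : (R.reduct X).Sat J := by
  simp only [initProg, Set.mem_union, Set.mem_iUnion] at hR
  obtain (⟨l, hl, rfl⟩ | ⟨c, hR⟩) | ⟨c, hR⟩ := hR
  · exact sat_reduct_rule_bot.2 h
  · exact D.sat_reduct_of_mem_valueConstraints hR h
  · exact D.sat_reduct_of_mem_valueConstraints hR h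

theorem mem_Tr_SM {X : Set (D.Atom m)} :
    X ∈ (D.Tr m).SM ↔ ∃ q s e p, X = D.interp (graph q) s e p ∧ D.InitSat q (s 0) ∧
      D.Settled (s 0) ∧ ∀ i : Fin m, D.Step (s i.castSucc) (e i) (p i) (s i.succ) := by
  have key : X ∈ (D.Tr m).SM ↔ (∀ R ∈ (D.initProg m).hard, R.Sat X) ∧
      (∀ R ∈ (D.prog m).hard, R.Sat X) ∧ D.IsMinimal (D.initpfAt ⁻¹' X) X := by
    rw [Program.mem_SM_iff, ← and_assoc]
    have hh : ∀ {P : Formula (D.Atom m) → Prop}, (∀ R ∈ (D.Tr m).hard, P R) ↔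
        (∀ R ∈ (D.initProg m).hard, P R) ∧ ∀ R ∈ (D.prog m).hard, P R := by
      intro P
      simp only [Tr, Set.mem_union, or_imp, forall_and]
    rw [hh]
    refine and_congr_right fun hX => forall_congr' fun J => forall_congr' fun hJ => ?_
    rw [hh, D.sat_reduct_prog_hard hX.2]
    have hsoft : ∀ r, r ∈ (D.Tr m).soft ↔ r ∈ (D.initProg m).soft ∨ r ∈ (D.prog m).soft := by
      intro r
      simp only [Tr, Finset.mem_union]
    constructor
    · intro h hR h₁ h₂
      refine h ⟨fun R hR => sat_reduct_of_mem_initProg_hard hR (hX.1 R hR), hR⟩ fun r hr hs => ?_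
      rcases (hsoft r).1 hr with hr | hr
      · obtain ⟨a, rfl⟩ := mem_initProg_soft.1 hr
        exact sat_reduct_atom.2 ⟨hs, h₂ a hs⟩
      · obtain ⟨i, a, rfl⟩ := mem_prog_soft.1 hr
        exact sat_reduct_atom.2 ⟨hs, h₁ i a hs⟩
    · intro h hR h₁
      refine h hR.2 (fun i a ha => ?_) fun a ha => ?_
      · exact (sat_reduct_atom.1
          (h₁ _ ((hsoft _).2 (Or.inr (mem_prog_soft.2 ⟨i, a, rfl⟩))) ha)).2
      · exact (sat_reduct_atom.1
          (h₁ _ ((hsoft _).2 (Or.inl (mem_initProg_soft.2 ⟨a, rfl⟩))) ha)).2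
  rw [key, hard_isMinimal_iff (le_refl _)]
  constructor
  · rintro ⟨hI, s, e, p, hX, h₀, hstep⟩
    have hs : D.FlEq X 0 (s 0) := hX ▸ flEq_interp 0
    obtain ⟨q, hq, hI⟩ := (sat_initProg_hard hs).1 hI
    have hq' : D.initpfAt ⁻¹' X = graph q := Set.ext fun a => hq a.1 a.2
    exact ⟨q, s, e, p, by rw [← hq']; exact hX, hI, h₀, hstep⟩
  · rintro ⟨q, s, e, p, rfl, hI, h₀, hstep⟩
    exact ⟨(sat_initProg_hard (flEq_interp 0)).2 ⟨q, fun _ _ => Iff.rfl, hI⟩,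
      s, e, p, rfl, h₀, hstep⟩

theorem isState_iff {s : σ.FlAssign} : D.IsState s ↔ D.Settled s := by
  constructor
  · rintro ⟨X, hX, hs⟩
    obtain ⟨s', e, p, rfl, h₀, -⟩ := mem_prog_SM.1 hX
    have : s = s' 0 := funext fun c => (hs c _).1 rfl
    exact this ▸ h₀
  · intro h
    exact ⟨_, mem_prog_SM.2 ⟨fun _ => s, Fin.elim0, Fin.elim0, rfl, h, fun i => i.elim0⟩,
      flEq_interp 0⟩

theorem isPfTransition_iff {s : σ.FlAssign} {e : σ.ActAssign} {s' : σ.FlAssign}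
    {p : σ.PfAssign} : D.IsPfTransition s e s' p ↔ D.Settled s ∧ D.Step s e p s' := by
  constructor
  · rintro ⟨X, hX, hs, he, hs', hp⟩
    obtain ⟨t, f, r, rfl, h₀, hstep⟩ := mem_prog_SM.1 hX
    obtain rfl : s = t 0 := funext fun c => (hs c _).1 rfl
    obtain rfl : s' = t 1 := funext fun c => (hs' c _).1 rfl
    obtain rfl : e = f 0 := funext fun c => (he c _).1 rfl
    obtain rfl : p = r 0 := funext fun c => (hp c _).1 rfl
    exact ⟨h₀, hstep 0⟩
  · rintro ⟨h₀, hstep⟩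
    refine ⟨_, mem_prog_SM.2 ⟨![s, s'], ![e], ![p], rfl, h₀, fun i => ?_⟩,
      fun _ _ => Iff.rfl, fun _ _ => Iff.rfl, fun _ _ => Iff.rfl, fun _ _ => Iff.rfl⟩
    obtain rfl := Subsingleton.elim i 0
    exact hstep

/-- If no transition executes actions concurrently, then no action does. -/
theorem NoConcurrency.atMostOne (h : D.NoConcurrency) (a : D.Action) : AtMostOne a.1 := by
  obtain ⟨e, X, hX, he⟩ := a
  obtain ⟨t, f, r, rfl, h₀, hstep⟩ := mem_prog_SM.1 hX
  exact h (t 0) e (t 1) ⟨_, hX, flEq_interp 0, he, flEq_interp 1⟩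

theorem TransitionsDetermined.existsUnique_step (h1 : D.NoConcurrency)
    (h2 : D.TransitionsDetermined) (s : D.State) (a : D.Action) (p : σ.PfAssign) :
    ∃! s' : D.State, D.Step s.1 a.1 p s'.1 := by
  obtain ⟨s', ⟨hs', ht⟩, huniq⟩ := h2 s.1 a.1 p s.2 (h1.atMostOne a)
  refine ⟨⟨s', hs'⟩, (isPfTransition_iff.1 ht).2, fun t ht' => Subtype.ext ?_⟩
  exact huniq t.1 ⟨t.2, isPfTransition_iff.2 ⟨isState_iff.1 s.2, ht'⟩⟩

end ActionDescription

/-! ### Expected utilities and weights -/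

namespace Program

variable {α : Type} [Fintype α] (P : Program α)

theorem probInterp_eq (I : Set α) : P.probInterp I = P.weight I / ∑ X, P.weight X := by
  classical
  rw [probInterp, Finset.sum_filter]
  refine congrArg _ (Finset.sum_congr rfl fun X _ => ?_)
  split_ifs with h
  · rfl
  · simp [weight, h]

open Classical in
theorem prob_eq (A : Formula α) :
    P.prob A = (∑ X, (if A.Sat X then 1 else 0) * P.weight X) / ∑ X, P.weight X := by
  simp only [prob, probInterp_eq, Finset.sum_filter, Finset.sum_div]
  refine Finset.sum_congr rfl fun X _ => ?_
  split_ifs <;> simp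

/-- If the total weight vanishes then so do all weights; hence the normalizing constant cancels
in every case. -/
theorem sum_mul_weight_of_sum_eq_zero (h : ∑ X, P.weight X = 0) (g : Set α → ℝ) :
    ∑ X, g X * P.weight X = 0 := by
  have := (Finset.sum_eq_zero_iff_of_nonneg fun X _ => P.weight_nonneg X).1 h
  exact Finset.sum_eq_zero fun X hX => by rw [this X hX, mul_zero]

open Classical in
theorem condProb_eq (B A : Formula α) :
    P.condProb B A = (∑ X, (if (A.and B).Sat X then 1 else 0) * P.weight X) /
      ∑ X, (if A.Sat X then 1 else 0) * P.weight X := by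
  rw [condProb, prob_eq, prob_eq]
  by_cases h : ∑ X, P.weight X = 0
  · simp only [P.sum_mul_weight_of_sum_eq_zero h, zero_div]
  · rw [div_div_div_cancel_right₀ h]

open Classical in
theorem expectedUtility_eq (A : Formula α) :
    P.expectedUtility A = (∑ X, (if A.Sat X then P.utility X else 0) * P.weight X) /
      ∑ X, (if A.Sat X then 1 else 0) * P.weight X := by
  rw [expectedUtility, prob_eq, Finset.sum_filter]
  simp only [probInterp_eq]
  generalize ∑ X, (if A.Sat X then 1 else 0) * P.weight X = a
  by_cases h : ∑ X, P.weight X = 0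
  · rw [P.sum_mul_weight_of_sum_eq_zero h, zero_div]
    simp [h]
  · rw [Finset.sum_div]
    refine Finset.sum_congr rfl fun X _ => ?_
    rw [div_div_div_cancel_right₀ h]
    split_ifs
    · rw [mul_div_assoc]
    · simp

end Program

namespace ActionDescription

variable {σ : Signature} (D : ActionDescription σ) {m : ℕ}

/-- The probability of the assignment `p` to the pf constants. -/
noncomputable def pfMass (p : σ.PfAssign) : ℝ := ∏ c, D.pfProb c (p c)

/-- The probability of the assignment `q` to the initpf constants. -/
noncomputable def initpfMass (q : σ.InitpfAssign) : ℝ := ∏ c, D.initpfProb c (q c)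

open Classical in
theorem sum_pfMass : ∑ p, D.pfMass p = 1 := by
  have := Finset.prod_univ_sum (fun c : σ.Pf => (Finset.univ : Finset (σ.pfDom c))) D.pfProb
  rw [Fintype.piFinset_univ] at this
  simp only [pfMass, ← this, D.pfProb_sum, Finset.prod_const_one]

theorem initpfMass_pos (q : σ.InitpfAssign) : 0 < D.initpfMass q :=
  Finset.prod_pos fun _ _ => D.initpfProb_pos _ _

variable {D}

theorem interp_injective {q q' : Set σ.InitpfAtom} {s s' : Fin (m + 1) → σ.FlAssign}
    {e e' : Fin m → σ.ActAssign} {p p' : Fin m → σ.PfAssign}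
    (h : D.interp q s e p = D.interp q' s' e' p') : q = q' ∧ s = s' ∧ e = e' ∧ p = p' := by
  have h' : ∀ a, a ∈ D.interp q s e p ↔ a ∈ D.interp q' s' e' p' := fun a => by rw [h]
  refine ⟨Set.ext fun a => h' (D.initpfAt a), ?_, ?_, ?_⟩
  · exact funext fun i => funext fun c => ((h' (.fl i c (s i c))).1 rfl).symm
  · exact funext fun i => funext fun c => ((h' (.act i c (e i c))).1 rfl).symm
  · exact funext fun i => funext fun c => ((h' (.pf i c (p i c))).1 rfl).symm

theorem graph_injective {ι : Type} {V : ι → Type} {f g : ∀ c, V c} (h : graph f = graph g) :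
    f = g :=
  funext fun c => (h.le (show (⟨c, f c⟩ : Σ c, V c) ∈ graph f from rfl)).symm

open Classical in
theorem sum_graph {ι : Type} [Fintype ι] {V : ι → Type} [∀ c, Fintype (V c)] (f : ∀ c, V c)
    (g : (Σ c, V c) → ℝ) :
    ∑ a : Σ c, V c, (if a ∈ graph f then g a else 0) = ∑ c, g ⟨c, f c⟩ := by
  rw [Fintype.sum_sigma]
  refine Finset.sum_congr rfl fun c _ => ?_
  exact (Finset.sum_eq_single (f c) (fun v _ hv => if_neg fun h => hv (Eq.symm h))
    fun h => absurd (Finset.mem_univ _) h).trans (if_pos rfl)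

open Classical in
theorem sum_prog_soft (q : Set σ.InitpfAtom) (s : Fin (m + 1) → σ.FlAssign)
    (e : Fin m → σ.ActAssign) (p : Fin m → σ.PfAssign) :
    ∑ r ∈ (D.prog m).soft with r.2.Sat (D.interp q s e p), r.1 =
      ∑ i, ∑ c, Real.log (D.pfProb c (p i c)) := by
  rw [Finset.sum_filter, prog, Finset.sum_image, Fintype.sum_prod_type]
  · refine Finset.sum_congr rfl fun i _ => ?_
    exact sum_graph (p i) fun a => Real.log (D.pfProb a.1 a.2)
  · rintro ⟨i, c, v⟩ - ⟨i', c', v'⟩ - h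
    have := (Prod.ext_iff.1 h).2
    simp only [pfAt, Formula.atom.injEq, Atom.pf.injEq] at this
    obtain ⟨rfl, rfl, h⟩ := this
    cases h
    rfl

open Classical in
theorem sum_initProg_soft (q : σ.InitpfAssign) (s : Fin (m + 1) → σ.FlAssign)
    (e : Fin m → σ.ActAssign) (p : Fin m → σ.PfAssign) :
    ∑ r ∈ (D.initProg m).soft with r.2.Sat (D.interp (graph q) s e p), r.1 =
      ∑ c, Real.log (D.initpfProb c (q c)) := by
  rw [Finset.sum_filter, initProg, Finset.sum_image]
  · exact sum_graph q fun a => Real.log (D.initpfProb a.1 a.2)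
  · rintro ⟨c, v⟩ - ⟨c', v'⟩ - h
    have := (Prod.ext_iff.1 h).2
    simp only [initpfAt, Formula.atom.injEq, Atom.initpf.injEq] at this
    obtain ⟨rfl, h⟩ := this
    cases h
    rfl

theorem exp_sum_log_pfProb (p : Fin m → σ.PfAssign) :
    Real.exp (∑ i, ∑ c, Real.log (D.pfProb c (p i c))) = ∏ i, D.pfMass (p i) := by
  simp only [Real.exp_sum, pfMass, Real.exp_log (D.pfProb_pos _ _)]

theorem exp_sum_log_initpfProb (q : σ.InitpfAssign) :
    Real.exp (∑ c, Real.log (D.initpfProb c (q c))) = D.initpfMass q := by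
  simp only [Real.exp_sum, initpfMass, Real.exp_log (D.initpfProb_pos _ _)]

open Classical in
theorem prog_weight_interp (s : Fin (m + 1) → D.State) (e : Fin m → σ.ActAssign)
    (p : Fin m → σ.PfAssign) :
    (D.prog m).weight (D.interp ∅ (fun i => (s i).1) e p) =
      ∏ i, if D.Step (s i.castSucc).1 (e i) (p i) (s i.succ).1 then D.pfMass (p i) else 0 := by
  have hmem : D.interp ∅ (fun i => (s i).1) e p ∈ (D.prog m).SM ↔
      ∀ i : Fin m, D.Step (s i.castSucc).1 (e i) (p i) (s i.succ).1 := by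
    rw [mem_prog_SM]
    constructor
    · rintro ⟨s', e', p', h, -, hstep⟩
      obtain ⟨-, rfl, rfl, rfl⟩ := interp_injective h
      exact hstep
    · exact fun h => ⟨_, e, p, rfl, isState_iff.1 (s 0).2, h⟩
  rw [Program.weight, Finset.prod_ite_zero, sum_prog_soft, exp_sum_log_pfProb]
  simp only [hmem, Finset.mem_univ, true_implies]

open Classical in
theorem Tr_weight_interp (q : σ.InitpfAssign) (s : Fin (m + 1) → D.State)
    (e : Fin m → σ.ActAssign) (p : Fin m → σ.PfAssign) :
    (D.Tr m).weight (D.interp (graph q) (fun i => (s i).1) e p) =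
      (if D.InitSat q (s 0).1 then D.initpfMass q else 0) *
      ∏ i, if D.Step (s i.castSucc).1 (e i) (p i) (s i.succ).1 then D.pfMass (p i) else 0 := by
  have hmem : D.interp (graph q) (fun i => (s i).1) e p ∈ (D.Tr m).SM ↔
      D.InitSat q (s 0).1 ∧
        ∀ i : Fin m, D.Step (s i.castSucc).1 (e i) (p i) (s i.succ).1 := by
    rw [mem_Tr_SM]
    constructor
    · rintro ⟨q', s', e', p', h, hI, -, hstep⟩
      obtain ⟨hq, rfl, rfl, rfl⟩ := interp_injective h
      exact ⟨graph_injective hq ▸ hI, hstep⟩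
    · exact fun h => ⟨q, _, e, p, rfl, h.1, isState_iff.1 (s 0).2, h.2⟩
  have hdisj : Disjoint (D.initProg m).soft (D.prog m).soft := by
    rw [Finset.disjoint_left]
    intro r h₁ h₂
    obtain ⟨a, rfl⟩ := mem_initProg_soft.1 h₁
    obtain ⟨i, b, h⟩ := mem_prog_soft.1 h₂
    have := (Prod.ext_iff.1 h).2
    simp only [initpfAt, pfAt, Formula.atom.injEq, reduceCtorEq] at this
  have hsum : ∑ r ∈ (D.Tr m).soft with r.2.Sat (D.interp (graph q) (fun i => (s i).1) e p), r.1 =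
      ∑ c, Real.log (D.initpfProb c (q c)) + ∑ i, ∑ c, Real.log (D.pfProb c (p i c)) := by
    rw [← sum_prog_soft (graph q) (fun i => (s i).1) e p,
      ← sum_initProg_soft q (fun i => (s i).1) e p, Finset.sum_filter, Finset.sum_filter,
      Finset.sum_filter, Tr, Finset.sum_union hdisj]
  rw [Program.weight, Finset.prod_ite_zero, hsum, Real.exp_add, exp_sum_log_pfProb,
    exp_sum_log_initpfProb]
  simp only [hmem, Finset.mem_univ, true_implies]
  split_ifs <;> simp_all

/-- The time steps of a stable model run through states. -/
theorem exists_state_of_steps {s : Fin (m + 1) → σ.FlAssign} {e : Fin m → σ.ActAssign}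
    {p : Fin m → σ.PfAssign} (h₀ : D.Settled (s 0))
    (hstep : ∀ i : Fin m, D.Step (s i.castSucc) (e i) (p i) (s i.succ)) :
    ∃ t : Fin (m + 1) → D.State, s = fun i => (t i).1 :=
  ⟨fun i => ⟨s i, isState_iff.2 (i.cases h₀ fun i => (hstep i).settled)⟩, rfl⟩

variable (D) in
open Classical in
/-- The probability that the pf constants take values that lead from `s` to `s'` by `e`. -/
noncomputable def stepProb (s : σ.FlAssign) (e : σ.ActAssign) (s' : σ.FlAssign) : ℝ :=
  ∑ p, if D.Step s e p s' then D.pfMass p else 0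

variable (D) in
open Classical in
/-- The probability that the initpf constants take values with which `s` satisfies the initial
static laws. -/
noncomputable def initWeight (s : σ.FlAssign) : ℝ :=
  ∑ q, if D.InitSat q s then D.initpfMass q else 0

open Classical in
/-- The pf values of different time steps are chosen independently. -/
theorem sum_prod_step (s : Fin (m + 1) → σ.FlAssign) (e : Fin m → σ.ActAssign) :
    ∑ p : Fin m → σ.PfAssign,
      (∏ i, if D.Step (s i.castSucc) (e i) (p i) (s i.succ) then D.pfMass (p i) else 0) =
      ∏ i, D.stepProb (s i.castSucc) (e i) (s i.succ) := by
  have := Finset.prod_univ_sum (fun _ : Fin m => (Finset.univ : Finset σ.PfAssign)) fun i p =>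
    if D.Step (s i.castSucc) (e i) p (s i.succ) then D.pfMass p else 0
  rw [Fintype.piFinset_univ] at this
  exact this.symm

open Classical in
theorem sum_mul_prog_weight {g : Set (D.Atom m) → ℝ}
    {g' : (Fin (m + 1) → D.State) → (Fin m → σ.ActAssign) → ℝ}
    (hg : ∀ s e p, g (D.interp ∅ (fun i => (s i).1) e p) = g' s e) :
    ∑ X, g X * (D.prog m).weight X =
      ∑ s, ∑ e, g' s e * ∏ i, D.stepProb (s i.castSucc).1 (e i) (s i.succ).1 := by
  have h := Fintype.sum_of_injective
    (fun x : (Fin (m + 1) → D.State) × (Fin m → σ.ActAssign) × (Fin m → σ.PfAssign) =>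
      D.interp ∅ (fun i => (x.1 i).1) x.2.1 x.2.2) ?_ _
    (fun X => g X * (D.prog m).weight X) ?_ fun _ => rfl
  · rw [← h, Fintype.sum_prod_type]
    refine Finset.sum_congr rfl fun s _ => ?_
    rw [Fintype.sum_prod_type]
    refine Finset.sum_congr rfl fun e _ => ?_
    simp only [hg, prog_weight_interp]
    rw [← Finset.mul_sum, sum_prod_step fun i => (s i).1]
  · rintro ⟨s, e, p⟩ ⟨s', e', p'⟩ h
    obtain ⟨-, hs, rfl, rfl⟩ := interp_injective h
    obtain rfl : s = s' := funext fun i => Subtype.ext (congrFun hs i)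
    rfl
  · intro X hX
    rw [Program.weight, if_neg, mul_zero]
    intro hSM
    obtain ⟨s, e, p, rfl, h₀, hstep⟩ := mem_prog_SM.1 hSM
    obtain ⟨t, rfl⟩ := exists_state_of_steps h₀ hstep
    exact hX ⟨(t, e, p), rfl⟩

open Classical in
theorem sum_mul_Tr_weight {g : Set (D.Atom m) → ℝ}
    {g' : (Fin (m + 1) → D.State) → (Fin m → σ.ActAssign) → ℝ}
    (hg : ∀ q s e p, g (D.interp q (fun i => (s i).1) e p) = g' s e) :
    ∑ X, g X * (D.Tr m).weight X = ∑ s, ∑ e, g' s e * (D.initWeight (s 0).1 *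
      ∏ i, D.stepProb (s i.castSucc).1 (e i) (s i.succ).1) := by
  have h := Fintype.sum_of_injective
    (fun x : (Fin (m + 1) → D.State) × (Fin m → σ.ActAssign) × σ.InitpfAssign ×
        (Fin m → σ.PfAssign) =>
      D.interp (graph x.2.2.1) (fun i => (x.1 i).1) x.2.1 x.2.2.2) ?_ _
    (fun X => g X * (D.Tr m).weight X) ?_ fun _ => rfl
  · rw [← h, Fintype.sum_prod_type]
    refine Finset.sum_congr rfl fun s _ => ?_
    rw [Fintype.sum_prod_type]
    refine Finset.sum_congr rfl fun e _ => ?_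
    simp only [hg, Tr_weight_interp]
    rw [← Finset.mul_sum, Fintype.sum_prod_type, initWeight, Finset.sum_mul]
    congr 1
    refine Finset.sum_congr rfl fun q _ => ?_
    rw [← sum_prod_step fun i => (s i).1, Finset.mul_sum]
  · rintro ⟨s, e, q, p⟩ ⟨s', e', q', p'⟩ h
    obtain ⟨hq, hs, rfl, rfl⟩ := interp_injective h
    obtain rfl : s = s' := funext fun i => Subtype.ext (congrFun hs i)
    obtain rfl : q = q' := graph_injective hq
    rfl
  · intro X hX
    rw [Program.weight, if_neg, mul_zero]
    intro hSM
    obtain ⟨q, s, e, p, rfl, -, h₀, hstep⟩ := mem_Tr_SM.1 hSM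
    obtain ⟨t, rfl⟩ := exists_state_of_steps h₀ hstep
    exact hX ⟨(t, e, q, p), rfl⟩

variable (D) in
open Classical in
/-- The reward that the utility laws give to the step from `s` to `s'` by `e`. -/
noncomputable def stepReward (s : σ.FlAssign) (e : σ.ActAssign) (s' : σ.FlAssign) : ℝ :=
  ∑ l : {l : UtilityLaw σ // l ∈ D.utilityLaws}, if Rewarded l.1 s e s' then l.1.reward else 0

open Classical in
theorem utility_interp {P : Program (D.Atom m)} (hP : P.value = D.atomValue)
    (q : Set σ.InitpfAtom) (s : Fin (m + 1) → σ.FlAssign) (e : Fin m → σ.ActAssign) (p : Fin m → σ.PfAssign) :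
    P.utility (D.interp q s e p) =
      ∑ i, D.stepReward (s i.castSucc) (e i) (s i.succ) := by
  rw [Program.utility, hP, Finset.sum_filter]
  have h := Fintype.sum_of_injective
    (fun x : Fin m × {l : UtilityLaw σ // l ∈ D.utilityLaws} => (Atom.utility x.2 x.1 : D.Atom m))
    ?_ _ (fun a => if a ∈ D.interp q s e p then D.atomValue a else 0) ?_ fun _ => rfl
  · rw [← h, Fintype.sum_prod_type]
    rfl
  · rintro ⟨i, l⟩ ⟨i', l'⟩ h
    cases h
    rfl
  · intro a ha
    cases a with
    | utility l i => exact absurd ⟨(i, l), rfl⟩ ha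
    | _ => exact ite_self _

/-! ### The Markov decision process -/

open Classical in
theorem sum_stepProb (h1 : D.NoConcurrency) (h2 : D.TransitionsDetermined) (s : D.State)
    (a : D.Action) : ∑ s' : D.State, D.stepProb s.1 a.1 s'.1 = 1 := by
  simp only [stepProb]
  rw [Finset.sum_comm, ← D.sum_pfMass]
  refine Finset.sum_congr rfl fun p _ => ?_
  obtain ⟨s', hs', huniq⟩ := h2.existsUnique_step h1 s a p
  rw [Finset.sum_eq_single s', if_pos hs']
  · exact fun t _ ht => if_neg fun h => ht (huniq t h)
  · exact fun h => absurd (Finset.mem_univ _) h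

open Classical in
/-- A sum over the stable models of `D_1`, as a sum over states and actions. -/
theorem sum_mul_prog_one_weight {g : Set (D.Atom 1) → ℝ}
    {g' : D.State → σ.ActAssign → D.State → ℝ}
    (hg : ∀ (s : Fin 2 → D.State) e p,
      g (D.interp ∅ (fun i => (s i).1) e p) = g' (s 0) (e 0) (s 1)) :
    ∑ X, g X * (D.prog 1).weight X =
      ∑ s, ∑ s', ∑ e, g' s e s' * D.stepProb s.1 e s'.1 := by
  rw [sum_mul_prog_weight hg]
  refine Eq.trans ?_ (Fintype.sum_prod_type' fun (s s' : D.State) =>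
    ∑ e, g' s e s' * D.stepProb s.1 e s'.1)
  refine Fintype.sum_equiv (finTwoArrowEquiv D.State) _ _ fun s => ?_
  refine Fintype.sum_equiv (Equiv.funUnique (Fin 1) σ.ActAssign) _ _ fun e => ?_
  rw [Fin.prod_univ_one]
  rfl

theorem sat_stateFormula_interp {q : Set σ.InitpfAtom} {s : Fin (m + 1) → D.State}
    {e : Fin m → σ.ActAssign} {p : Fin m → σ.PfAssign} {i : Fin (m + 1)} {t : D.State} :
    (D.stateFormula i t).Sat (D.interp q (fun i => (s i).1) e p) ↔ s i = t := by
  rw [stateFormula, sat_conj]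
  exact ⟨fun h => Subtype.ext (funext h), fun h c => by subst h; rfl⟩

theorem sat_actionFormula_interp {q : Set σ.InitpfAtom} {s : Fin (m + 1) → D.State}
    {e : Fin m → σ.ActAssign} {p : Fin m → σ.PfAssign} {i : Fin m} {a : D.Action} :
    (D.actionFormula i a).Sat (D.interp q (fun i => (s i).1) e p) ↔ e i = a.1 := by
  rw [actionFormula, sat_conj]
  exact ⟨fun h => funext h, fun h c => congrFun h c⟩

theorem sat_policyFormula_interp {q : Set σ.InitpfAtom} {s : Fin (m + 1) → D.State}
    {e : Fin m → σ.ActAssign} {p : Fin m → σ.PfAssign} {π : D.Policy m} :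
    (D.policyFormula π).Sat (D.interp q (fun i => (s i).1) e p) ↔
      e = fun i => (π (s i.castSucc, i)).1 := by
  rw [policyFormula, sat_conj]
  simp only [Sat, sat_stateFormula_interp, sat_actionFormula_interp]
  constructor
  · exact fun h => funext fun i => h (s i.castSucc, i) rfl
  · rintro rfl ⟨t, i⟩ ht
    exact congrArg (fun u => (π (u, i)).1) ht

open Classical in
theorem toMDP_T (h1 : D.NoConcurrency) (h2 : D.TransitionsDetermined) (s : D.State)
    (a : D.Action) (s' : D.State) : D.toMDP.T s a s' = D.stepProb s.1 a.1 s'.1 := by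
  change (D.prog 1).condProb _ _ = _
  rw [Program.condProb_eq,
    sum_mul_prog_one_weight (g' := fun t e t' => if (t = s ∧ e = a.1) ∧ t' = s' then 1 else 0),
    sum_mul_prog_one_weight (g' := fun t e _ => if t = s ∧ e = a.1 then 1 else 0)]
  · have h : ∑ t : D.State, ∑ t' : D.State, ∑ e : σ.ActAssign,
        (if t = s ∧ e = a.1 then (1 : ℝ) else 0) * D.stepProb t.1 e t'.1 = 1 := by
      simp only [ite_and, ite_mul, one_mul, zero_mul, Finset.sum_ite_irrel, Finset.sum_ite_eq',
        Finset.sum_const_zero, Finset.mem_univ, if_true, sum_stepProb h1 h2 s a]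
    rw [h, div_one]
    simp [ite_and, Finset.sum_ite_irrel]
  · intro t e p
    simp only [Sat, sat_stateFormula_interp, sat_actionFormula_interp]
  · intro t e p
    simp only [Sat, sat_stateFormula_interp, sat_actionFormula_interp]

open Classical in
/-- The rewards of `M(D)` are the ones that the utility laws assign, except at the triples of
transition probability `0`. -/
theorem toMDP_R {s : D.State} {a : D.Action} {s' : D.State}
    (h : D.stepProb s.1 a.1 s'.1 ≠ 0) : D.toMDP.R s a s' = D.stepReward s.1 a.1 s'.1 := by
  change (D.prog 1).expectedUtility _ = _
  rw [Program.expectedUtility_eq,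
    sum_mul_prog_one_weight (g' := fun t e t' =>
      if (t = s ∧ e = a.1) ∧ t' = s' then D.stepReward t.1 e t'.1 else 0),
    sum_mul_prog_one_weight (g' := fun t e t' => if (t = s ∧ e = a.1) ∧ t' = s' then 1 else 0)]
  · simp only [ite_and, ite_mul, one_mul, zero_mul, Finset.sum_ite_irrel, Finset.sum_ite_eq',
      Finset.sum_const_zero, Finset.mem_univ, if_true]
    rw [mul_div_assoc, div_self h, mul_one]
  · intro t e p
    simp only [Sat, sat_stateFormula_interp, sat_actionFormula_interp]
  · intro t e p
    simp only [Sat, sat_stateFormula_interp, sat_actionFormula_interp]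
    rw [utility_interp (P := D.prog 1) rfl, Fin.sum_univ_one]
    rfl

/-- The probabilities of the trajectories of a time-dependent Markov chain that start at a given
point sum to `1`. -/
theorem sum_prod_kernel {S : Type} [Fintype S] {n : ℕ} (K : Fin n → S → S → ℝ)
    (hK : ∀ i s, ∑ s', K i s s' = 1) (s₀ : S) :
    ∑ t : Fin n → S, ∏ i : Fin n,
      K i ((Fin.cons s₀ t : Fin (n + 1) → S) i.castSucc)
        ((Fin.cons s₀ t : Fin (n + 1) → S) i.succ) = 1 := by
  induction n generalizing s₀ with
  | zero => simp
  | succ n ih =>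
    rw [← (Fin.consEquiv fun _ => S).sum_comp, Fintype.sum_prod_type, ← hK 0 s₀]
    refine Finset.sum_congr rfl fun s₁ _ => ?_
    simp only [Fin.prod_univ_succ]
    have := ih (fun i => K i.succ) (fun i => hK i.succ) s₁
    rw [← mul_one (K 0 s₀ s₁), ← this, Finset.mul_sum]
    refine Finset.sum_congr rfl fun t _ => ?_
    rfl

theorem initWeight_pos {s : D.State} (h : D.ConsistentInit s) : 0 < D.initWeight s.1 := by
  classical
  obtain ⟨X, hX, hs⟩ := h
  obtain ⟨q, t, e, p, rfl, hI, h₀, hstep⟩ := mem_Tr_SM.1 hX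
  obtain ⟨t, rfl⟩ := exists_state_of_steps h₀ hstep
  obtain rfl := sat_stateFormula_interp.1 hs
  refine Finset.sum_pos' (fun q _ => ?_) ⟨q, Finset.mem_univ q, ?_⟩
  · split_ifs
    · exact (D.initpfMass_pos q).le
    · exact le_rfl
  · rw [if_pos hI]
    exact D.initpfMass_pos q

open Classical in
/-- A sum over the stable models of `Tr(D, m)` that start at `s₀` and follow the policy `π`. -/
theorem sum_policy_mul_Tr_weight {π : D.Policy m} {s₀ : D.State} {g : Set (D.Atom m) → ℝ}
    {g' : (Fin (m + 1) → D.State) → (Fin m → σ.ActAssign) → ℝ}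
    (hg : ∀ q s e p, g (D.interp q (fun i => (s i).1) e p) = g' s e) :
    ∑ X, (if ((D.policyFormula π).and (D.stateFormula 0 s₀)).Sat X then g X else 0) *
        (D.Tr m).weight X =
      D.initWeight s₀.1 * ∑ t : Fin m → D.State,
        let s : Fin (m + 1) → D.State := Fin.cons s₀ t
        g' s (fun i => (π (s i.castSucc, i)).1) *
          ∏ i, D.stepProb (s i.castSucc).1 (π (s i.castSucc, i)).1 (s i.succ).1 := by
  rw [sum_mul_Tr_weight (g' := fun s e =>
    if s 0 = s₀ then if e = fun i => (π (s i.castSucc, i)).1 then g' s e else 0 else 0)]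
  · simp only [ite_mul, zero_mul, Finset.sum_ite_irrel, Finset.sum_ite_eq',
      Finset.sum_const_zero, Finset.mem_univ, if_true]
    rw [← (Fin.consEquiv fun _ => D.State).sum_comp, Fintype.sum_prod_type]
    simp only [Fin.consEquiv, Equiv.coe_fn_mk, Fin.cons_zero, Finset.sum_ite_irrel,
      Finset.sum_const_zero, Finset.sum_ite_eq', Finset.mem_univ, if_true, Finset.mul_sum]
    refine Finset.sum_congr rfl fun t _ => ?_
    ring
  · intro q s e p
    simp only [Sat, sat_stateFormula_interp, sat_policyFormula_interp, hg]
    split_ifs <;> tauto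

theorem expectedUtility_policy (h1 : D.NoConcurrency) (h2 : D.TransitionsDetermined)
    {s₀ : D.State} (hs₀ : D.ConsistentInit s₀) (π : D.Policy m) :
    (D.Tr m).expectedUtility ((D.policyFormula π).and (D.stateFormula 0 s₀)) =
      D.toMDP.expectedTotalReward π s₀ := by
  classical
  rw [Program.expectedUtility_eq,
    sum_policy_mul_Tr_weight (g := (D.Tr m).utility)
      fun q s e p => utility_interp (P := D.Tr m) rfl q (fun i => (s i).1) e p,
    sum_policy_mul_Tr_weight (g := fun _ => 1) (g' := fun _ _ => 1) fun _ _ _ _ => rfl]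
  have hsum := sum_prod_kernel (S := D.State) (n := m)
    (fun i s s' => D.stepProb s.1 (π (s, i)).1 s'.1)
    (fun i s => sum_stepProb h1 h2 s (π (s, i))) s₀
  simp only [one_mul]
  rw [hsum, mul_one, mul_div_cancel_left₀ _ (initWeight_pos hs₀).ne']
  refine Finset.sum_congr rfl fun t _ => ?_
  simp only [MDP.totalReward, MDP.historyProb, toMDP_T h1 h2]
  by_cases h : ∏ i, D.stepProb ((Fin.cons s₀ t : Fin (m + 1) → D.State) i.castSucc).1
      (π ((Fin.cons s₀ t : Fin (m + 1) → D.State) i.castSucc, i)).1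
      ((Fin.cons s₀ t : Fin (m + 1) → D.State) i.succ).1 = 0
  · rw [h, mul_zero, mul_zero]
  · congr 1
    refine Finset.sum_congr rfl fun i _ => ?_
    exact (toMDP_R (Finset.prod_ne_zero_iff.1 h i (Finset.mem_univ i))).symm

end ActionDescription

end PBC

theorem mainTheorem1 {σ : PBC.Signature} (D : PBC.ActionDescription σ)
    (h1 : D.NoConcurrency) (h2 : D.TransitionsDetermined) (h3 : D.InitialDetermined)
    (m : ℕ) (s₀ : D.State) (hs₀ : D.ConsistentInit s₀) :
    (∀ π : D.Policy m,
      (D.Tr m).expectedUtility ((D.policyFormula π).and (D.stateFormula 0 s₀)) =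
        D.toMDP.expectedTotalReward π s₀) ∧
    PBC.argmax (fun π : D.Policy m =>
      (D.Tr m).expectedUtility ((D.policyFormula π).and (D.stateFormula 0 s₀))) =
    PBC.argmax (fun π : D.Policy m => D.toMDP.expectedTotalReward π s₀) := by
  have h := fun π : D.Policy m => PBC.ActionDescription.expectedUtility_policy h1 h2 hs₀ π
  exact ⟨h, congrArg PBC.argmax (funext h)⟩
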